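/- Let $\mathbb{D}$ be the open unit disk of $\mathbb{C}$, $\mathbb{T}$ the unit circle with normalized Lebesgue measure $\lambda$, and $1\le p<\infty$; let $L^p(\mathbb{T},\lambda)$ be the space of complex $p$-integrable functions. Let $\varphi$ be an automorphism of $\mathbb{D}$, i.e. a biholomorphic self-map of $\mathbb{D}$. Then $\varphi$ extends continuously to a map $\varphi:\mathbb{T}\to\mathbb{T}$, this boundary map satisfies $\lambda(\varphi^{-1}(B))\le c\,\lambda(B)$ for some $c>0$ and all measurable $B\subseteq\mathbb{T}$, so that $T_\varphi f=f\circ\varphi$ defines a bounded operator $T_\varphi$ on $L^p(\mathbb{T},\lambda)$, and the following assertions are equivalent: (i) $T_\varphi$ is Li–Yorke chaotic; (ii) $T_\varphi$ is distributionally chaotic; (iii) $T_\varphi$ is densely distributionally chaotic; (iv) $T_\varphi$ is topologically transitive; (v) $T_\varphi$ is topologically mixing; (vi) $\varphi$ has no fixed point in $\mathbb{D}$. Here, for a bounded operator $T$ on a Banach space $X$: $T$ is *Li–Yorke chaotic* if there is an uncountable $\Gamma\subseteq X$ such that $\liminf_n\|T^nx-T^ny\|=0$ and $\limsup_n\|T^nx-T^ny\|>0$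 for all distinct $x,y\in\Gamma$. $T$ is *distributionally chaotic* if there are an uncountable $\Gamma\subseteq X$ and $\varepsilon>0$ such that for every $\delta>0$ and all distinct $x,y\in\Gamma$ the set $\{j\in\mathbb{N}:\|T^jx-T^jy\|<\varepsilon\}$ has lower density $0$ and the set $\{j\in\mathbb{N}:\|T^jx-T^jy\|<\delta\}$ has upper density $1$; it is *densely distributionally chaotic* if moreover $\Gamma$ can be chosen dense in $X$. The upper and lower densities of $A\subseteq\mathbb{N}$ are the $\limsup$ and $\liminf$, as $N\to\infty$, of $\operatorname{card}\{1\le n\le N: n\in A\}/N$. $T$ is *topologically transitive* if for all nonempty open $U,V\subseteq X$ there is $n\geq 0$ with $T^n(U)\cap V\ne\emptyset$, and *topologically mixing* if for all such $U,V$ one has $T^n(U)\cap V\neq\emptyset$ for all sufficiently large $n$. -/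

import Mathlib

open MeasureTheory Filter Topology
open scoped ENNReal NNReal

/-! ### Densities of sets of natural numbers -/

/-- The upper density `limsup_{N → ∞} card {1 ≤ n ≤ N : n ∈ A} / N`. -/
noncomputable def upperDensity (A : Set ℕ) : ℝ :=
  limsup (fun N : ℕ => ((A ∩ Set.Icc 1 N).ncard : ℝ) / (N : ℝ)) atTop

/-- The lower density `liminf_{N → ∞} card {1 ≤ n ≤ N : n ∈ A} / N`. -/
noncomputable def lowerDensity (A : Set ℕ) : ℝ :=
  liminf (fun N : ℕ => ((A ∩ Set.Icc 1 N).ncard : ℝ) / (N : ℝ)) atTop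

/-! ### Chaos notions for bounded operators -/

section Chaos

variable {E : Type*} [NormedAddCommGroup E] [NormedSpace ℂ E]

/-- `T` is Li-Yorke chaotic: there is an uncountable set all of whose pairs of distinct points are
Li-Yorke pairs (the `liminf` and `limsup` are taken in `[0, ∞]`). -/
def LiYorkeChaotic (T : E →L[ℂ] E) : Prop :=
  ∃ Γ : Set E, ¬ Γ.Countable ∧ ∀ x ∈ Γ, ∀ y ∈ Γ, x ≠ y →
    liminf (fun n : ℕ => edist ((T ^ n) x) ((T ^ n) y)) atTop = 0 ∧
    0 < limsup (fun n : ℕ => edist ((T ^ n) x) ((T ^ n) y)) atTop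

/-- `Γ` is a distributionally `ε`-scrambled set for `T` (apart from being uncountable). -/
def DistributionallyScrambled (T : E →L[ℂ] E) (ε : ℝ) (Γ : Set E) : Prop :=
  ∀ δ : ℝ, 0 < δ → ∀ x ∈ Γ, ∀ y ∈ Γ, x ≠ y →
    lowerDensity {j : ℕ | ‖(T ^ j) x - (T ^ j) y‖ < ε} = 0 ∧
    upperDensity {j : ℕ | ‖(T ^ j) x - (T ^ j) y‖ < δ} = 1

/-- `T` is distributionally chaotic. -/
def DistributionallyChaotic (T : E →L[ℂ] E) : Prop :=
  ∃ (Γ : Set E) (ε : ℝ), ¬ Γ.Countable ∧ 0 < ε ∧ DistributionallyScrambled T ε Γ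

/-- `T` is densely distributionally chaotic: the scrambled set may be chosen dense. -/
def DenselyDistributionallyChaotic (T : E →L[ℂ] E) : Prop :=
  ∃ (Γ : Set E) (ε : ℝ), Dense Γ ∧ ¬ Γ.Countable ∧ 0 < ε ∧ DistributionallyScrambled T ε Γ

/-- `T` is topologically transitive. -/
def TopologicallyTransitive (T : E →L[ℂ] E) : Prop :=
  ∀ U V : Set E, IsOpen U → U.Nonempty → IsOpen V → V.Nonempty →
    ∃ n : ℕ, (((T ^ n) '' U) ∩ V).Nonempty

/-- `T` is topologically mixing. -/
def TopologicallyMixing (T : E →L[ℂ] E) : Prop :=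
  ∀ U V : Set E, IsOpen U → U.Nonempty → IsOpen V → V.Nonempty →
    ∃ N : ℕ, ∀ n : ℕ, N ≤ n → (((T ^ n) '' U) ∩ V).Nonempty

end Chaos

/-! ### Composition operators on `L^p` -/

section Composition

variable {X : Type*} [MeasurableSpace X]

/-- An inducing map: a measurable self-map `ψ` with `μ (ψ⁻¹ B) ≤ c μ B` for some constant `c > 0`
and all measurable `B`. -/
def IsInducingMap (μ : Measure X) (ψ : X → X) : Prop :=
  Measurable ψ ∧ ∃ c : ℝ≥0, 0 < c ∧ ∀ B : Set X, MeasurableSet B → μ (ψ ⁻¹' B) ≤ c * μ B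

variable {μ : Measure X} {ψ : X → X}

theorem IsInducingMap.exists_map_le (h : IsInducingMap μ ψ) :
    ∃ c : ℝ≥0, μ.map ψ ≤ (c : ℝ≥0∞) • μ := by
  obtain ⟨hm, c, -, hc⟩ := h
  refine ⟨c, Measure.le_iff.2 fun B hB => ?_⟩
  rw [Measure.map_apply hm hB]
  simpa using hc B hB

theorem IsInducingMap.quasiMeasurePreserving (h : IsInducingMap μ ψ) :
    Measure.QuasiMeasurePreserving ψ μ μ := by
  obtain ⟨c, hc⟩ := h.exists_map_le
  exact ⟨h.1, (Measure.absolutelyContinuous_of_le hc).trans Measure.smul_absolutelyContinuous⟩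

theorem IsInducingMap.memLp_comp (h : IsInducingMap μ ψ) {p : ℝ≥0∞} {f : X → ℂ}
    (hf : MemLp f p μ) : MemLp (f ∘ ψ) p μ := by
  obtain ⟨c, hc⟩ := h.exists_map_le
  exact (hf.of_measure_le_smul ENNReal.coe_ne_top hc).comp_of_map h.1.aemeasurable

theorem IsInducingMap.exists_eLpNorm_comp_le (h : IsInducingMap μ ψ) (p : ℝ≥0∞)
    (hp : p ≠ ∞) :
    ∃ K : ℝ≥0, ∀ f : X → ℂ, MemLp f p μ → eLpNorm (f ∘ ψ) p μ ≤ K * eLpNorm f p μ := by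
  obtain ⟨c, hc⟩ := h.exists_map_le
  refine ⟨c ^ (1 / p).toReal, fun f hf => ?_⟩
  have h1 := hf.of_measure_le_smul ENNReal.coe_ne_top hc
  rw [← eLpNorm_map_measure h1.1 h.1.aemeasurable]
  refine (eLpNorm_mono_measure f hc).trans ?_
  rw [eLpNorm_smul_measure_of_ne_top hp, smul_eq_mul,
    ENNReal.coe_rpow_of_nonneg _ ENNReal.toReal_nonneg]

/-- The composition operator `T_ψ f = f ∘ ψ` on `L^p(X, μ)`, `1 ≤ p < ∞`, induced by an inducing
map `ψ`. -/
noncomputable def compositionOperator (p : ℝ≥0∞) [Fact (1 ≤ p)] (hp : p ≠ ∞)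
    (h : IsInducingMap μ ψ) : Lp ℂ p μ →L[ℂ] Lp ℂ p μ :=
  LinearMap.mkContinuousOfExistsBound
    { toFun := fun f => (h.memLp_comp (Lp.memLp f)).toLp (f ∘ ψ)
      map_add' := fun f g => by
        rw [← MemLp.toLp_add]
        exact MemLp.toLp_congr _ _ (h.quasiMeasurePreserving.ae_eq_comp (Lp.coeFn_add f g))
      map_smul' := fun a f => by
        rw [RingHom.id_apply, ← MemLp.toLp_const_smul]
        exact MemLp.toLp_congr _ _ (h.quasiMeasurePreserving.ae_eq_comp (Lp.coeFn_smul a f)) }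
    (by
      obtain ⟨K, hK⟩ := h.exists_eLpNorm_comp_le p hp
      refine ⟨K, fun f => ?_⟩
      have h1 := ENNReal.toReal_mono
        (ENNReal.mul_ne_top ENNReal.coe_ne_top (Lp.eLpNorm_ne_top f)) (hK f (Lp.memLp f))
      rw [ENNReal.toReal_mul, ← Lp.norm_def] at h1
      exact (Lp.norm_toLp _ (h.memLp_comp (Lp.memLp f))).trans_le h1)

/-- The operator acts as `f ↦ f ∘ ψ`, whatever representative of `f` is used. -/
theorem compositionOperator_toLp (p : ℝ≥0∞) [Fact (1 ≤ p)] (hp : p ≠ ∞)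
    (h : IsInducingMap μ ψ) {f : X → ℂ} (hf : MemLp f p μ) :
    compositionOperator p hp h (hf.toLp f) = (h.memLp_comp hf).toLp (f ∘ ψ) :=
  MemLp.toLp_congr (h.memLp_comp (Lp.memLp _)) (h.memLp_comp hf)
    (h.quasiMeasurePreserving.ae_eq_comp hf.coeFn_toLp)

end Composition

/-! ### The unit circle and automorphisms of the unit disk -/

noncomputable instance : MeasurableSpace Circle := borel Circle

instance : BorelSpace Circle := ⟨rfl⟩

/-- Normalized Lebesgue (arc length) measure on the unit circle. -/
noncomputable def circleMeasure : Measure Circle :=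
  (ENNReal.ofReal (2 * Real.pi))⁻¹ •
    (volume.restrict (Set.Ioc (-Real.pi) Real.pi)).map Circle.exp

/-- `φ` restricts to an automorphism of the open unit disk `𝔻`, i.e. to a biholomorphic self-map
of `𝔻`. The values of `φ` outside `𝔻` are irrelevant. -/
def IsDiskAutomorphism (φ : ℂ → ℂ) : Prop :=
  DifferentiableOn ℂ φ (Metric.ball 0 1) ∧ Set.MapsTo φ (Metric.ball 0 1) (Metric.ball 0 1) ∧
    ∃ g : ℂ → ℂ, DifferentiableOn ℂ g (Metric.ball 0 1) ∧
      Set.MapsTo g (Metric.ball 0 1) (Metric.ball 0 1) ∧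
      Set.InvOn g φ (Metric.ball 0 1) (Metric.ball 0 1)

/-- `φ` tends to the unimodular number `w` at the point `ζ` of the circle, from inside `𝔻`. -/
def HasBoundaryValue (φ : ℂ → ℂ) (ζ w : Circle) : Prop :=
  Tendsto φ (𝓝[Metric.ball 0 1] (ζ : ℂ)) (𝓝 (w : ℂ))

open Classical in
/-- The boundary map of `φ`: its extension to the unit circle by continuity from inside `𝔻`. -/
noncomputable def boundaryMap (φ : ℂ → ℂ) (ζ : Circle) : Circle :=
  if h : ∃ w : Circle, HasBoundaryValue φ ζ w then h.choose else 1

/-! ### Elementary facts on densities -/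

theorem ncard_inter_Icc_div_nonneg (A : Set ℕ) (N : ℕ) :
    0 ≤ ((A ∩ Set.Icc 1 N).ncard : ℝ) / (N : ℝ) := by positivity

theorem ncard_inter_Icc_le (A : Set ℕ) (N : ℕ) : (A ∩ Set.Icc 1 N).ncard ≤ N := by
  calc (A ∩ Set.Icc 1 N).ncard ≤ (Set.Icc 1 N).ncard :=
        Set.ncard_le_ncard Set.inter_subset_right (Set.finite_Icc _ _)
    _ = N := by simp [Set.ncard_eq_toFinset_card']

theorem ncard_inter_Icc_div_le_one (A : Set ℕ) (N : ℕ) :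
    ((A ∩ Set.Icc 1 N).ncard : ℝ) / (N : ℝ) ≤ 1 :=
  div_le_one_of_le₀ (by exact_mod_cast ncard_inter_Icc_le A N) N.cast_nonneg

theorem isBoundedUnder_le_ncard_div (A : Set ℕ) :
    IsBoundedUnder (· ≤ ·) atTop fun N : ℕ => ((A ∩ Set.Icc 1 N).ncard : ℝ) / (N : ℝ) :=
  isBoundedUnder_of ⟨1, ncard_inter_Icc_div_le_one A⟩

theorem isBoundedUnder_ge_ncard_div (A : Set ℕ) :
    IsBoundedUnder (· ≥ ·) atTop fun N : ℕ => ((A ∩ Set.Icc 1 N).ncard : ℝ) / (N : ℝ) :=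
  isBoundedUnder_of ⟨0, ncard_inter_Icc_div_nonneg A⟩

theorem upperDensity_eq_one_iff (A : Set ℕ) :
    upperDensity A = 1 ↔
      ∀ r < (1 : ℝ), ∃ᶠ N : ℕ in atTop, r < ((A ∩ Set.Icc 1 N).ncard : ℝ) / (N : ℝ) := by
  have hle : upperDensity A ≤ 1 := by
    refine limsup_le_of_le (isBoundedUnder_ge_ncard_div A).isCoboundedUnder_le ?_
    exact Eventually.of_forall (ncard_inter_Icc_div_le_one A)
  constructor
  · intro h r hr
    exact frequently_lt_of_lt_limsup (isBoundedUnder_ge_ncard_div A).isCoboundedUnder_le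
      (by rw [← h] at hr; exact hr)
  · intro h
    refine le_antisymm hle (le_of_forall_lt_imp_le_of_dense fun r hr => ?_)
    exact le_limsup_of_frequently_le ((h r hr).mono fun N hN => hN.le)
      (isBoundedUnder_le_ncard_div A)

theorem lowerDensity_eq_zero_iff (A : Set ℕ) :
    lowerDensity A = 0 ↔
      ∀ r > (0 : ℝ), ∃ᶠ N : ℕ in atTop, ((A ∩ Set.Icc 1 N).ncard : ℝ) / (N : ℝ) < r := by
  have hge : 0 ≤ lowerDensity A := by
    refine le_liminf_of_le (isBoundedUnder_le_ncard_div A).isCoboundedUnder_ge ?_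
    exact Eventually.of_forall (ncard_inter_Icc_div_nonneg A)
  constructor
  · intro h r hr
    exact frequently_lt_of_liminf_lt (isBoundedUnder_le_ncard_div A).isCoboundedUnder_ge
      (by rw [← h] at hr; exact hr)
  · intro h
    refine le_antisymm (le_of_forall_gt_imp_ge_of_dense fun r hr => ?_) hge
    exact liminf_le_of_frequently_le ((h r hr).mono fun N hN => hN.le)
      (isBoundedUnder_ge_ncard_div A)

/-- Up to an initial segment, an eventual inclusion of sets controls the counting functions. -/
theorem ncard_div_le_add_of_eventually_subset {A B : Set ℕ} {m : ℕ}
    (h : ∀ n, m ≤ n → n ∈ A → n ∈ B) (N : ℕ) :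
    ((A ∩ Set.Icc 1 N).ncard : ℝ) / (N : ℝ) ≤ ((B ∩ Set.Icc 1 N).ncard : ℝ) / (N : ℝ) + m / N := by
  have hsub : A ∩ Set.Icc 1 N ⊆ (B ∩ Set.Icc 1 N) ∪ Set.Iio m := by
    rintro n ⟨hn, hnN⟩
    rcases lt_or_ge n m with hm | hm
    · exact Or.inr hm
    · exact Or.inl ⟨h n hm hn, hnN⟩
  have hcard : (A ∩ Set.Icc 1 N).ncard ≤ (B ∩ Set.Icc 1 N).ncard + m := by
    refine (Set.ncard_le_ncard hsub
      (((Set.finite_Icc 1 N).inter_of_right B).union (Set.finite_Iio m))).trans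
      ((Set.ncard_union_le _ _).trans ?_)
    simp [Set.ncard_eq_toFinset_card']
  rw [← add_div]
  gcongr
  exact_mod_cast hcard

theorem upperDensity_eq_one_of_eventually_subset {A B : Set ℕ}
    (h : ∀ᶠ n in atTop, n ∈ A → n ∈ B) (hA : upperDensity A = 1) : upperDensity B = 1 := by
  obtain ⟨m, hm⟩ := eventually_atTop.1 h
  rw [upperDensity_eq_one_iff] at hA ⊢
  intro r hr
  have h1 : ∀ᶠ N : ℕ in atTop, (m : ℝ) / N < (1 - r) / 2 :=
    (tendsto_const_div_atTop_nhds_zero_nat (m : ℝ)).eventually_lt_const (by linarith)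
  refine ((hA ((1 + r) / 2) (by linarith)).and_eventually h1).mono fun N hN => ?_
  have := ncard_div_le_add_of_eventually_subset hm N
  linarith [hN.1, hN.2]

theorem lowerDensity_eq_zero_of_eventually_subset {A B : Set ℕ}
    (h : ∀ᶠ n in atTop, n ∈ A → n ∈ B) (hB : lowerDensity B = 0) : lowerDensity A = 0 := by
  obtain ⟨m, hm⟩ := eventually_atTop.1 h
  rw [lowerDensity_eq_zero_iff] at hB ⊢
  intro r hr
  have h1 : ∀ᶠ N : ℕ in atTop, (m : ℝ) / N < r / 2 :=
    (tendsto_const_div_atTop_nhds_zero_nat (m : ℝ)).eventually_lt_const (by linarith)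
  refine ((hB (r / 2) (by linarith)).and_eventually h1).mono fun N hN => ?_
  have := ncard_div_le_add_of_eventually_subset hm N
  linarith [hN.1, hN.2]

theorem lowerDensity_eq_one_of_eventually_mem {A : Set ℕ} (h : ∀ᶠ n in atTop, n ∈ A) :
    lowerDensity A = 1 := by
  have huniv : Tendsto (fun N : ℕ => (((Set.univ : Set ℕ) ∩ Set.Icc 1 N).ncard : ℝ) / (N : ℝ))
      atTop (𝓝 1) := by
    refine tendsto_const_nhds.congr' ?_
    filter_upwards [eventually_gt_atTop 0] with N hN
    have : (N : ℝ) ≠ 0 := by positivity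
    simp [Set.ncard_eq_toFinset_card', this]
  obtain ⟨m, hm⟩ := eventually_atTop.1 h
  refine Tendsto.liminf_eq (tendsto_of_tendsto_of_tendsto_of_le_of_le
    (g := fun N : ℕ => (((Set.univ : Set ℕ) ∩ Set.Icc 1 N).ncard : ℝ) / (N : ℝ) - m / N)
    (by simpa using huniv.sub (tendsto_const_div_atTop_nhds_zero_nat (m : ℝ)))
    tendsto_const_nhds (fun N => ?_) (ncard_inter_Icc_div_le_one A))
  have := ncard_div_le_add_of_eventually_subset (A := Set.univ) (B := A)
    (fun n hn _ => hm n hn) N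
  dsimp only
  linarith

theorem frequently_mem_of_upperDensity_eq_one {A : Set ℕ} (h : upperDensity A = 1) :
    ∃ᶠ n in atTop, n ∈ A := by
  intro hA
  have h0 : upperDensity (∅ : Set ℕ) = 1 :=
    upperDensity_eq_one_of_eventually_subset (hA.mono fun n hn hn' => hn hn') h
  simp [upperDensity] at h0

theorem frequently_notMem_of_lowerDensity_eq_zero {A : Set ℕ} (h : lowerDensity A = 0) :
    ∃ᶠ n in atTop, n ∉ A := by
  intro hA
  have := lowerDensity_eq_one_of_eventually_mem (hA.mono fun n hn => not_not.1 hn)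
  linarith

/-! ### Chaos of operators -/

section Operators

variable {E : Type*} [NormedAddCommGroup E] [NormedSpace ℂ E]

theorem DenselyDistributionallyChaotic.distributionallyChaotic {T : E →L[ℂ] E}
    (h : DenselyDistributionallyChaotic T) : DistributionallyChaotic T := by
  obtain ⟨Γ, ε, -, h⟩ := h
  exact ⟨Γ, ε, h⟩

theorem DistributionallyChaotic.liYorkeChaotic {T : E →L[ℂ] E}
    (h : DistributionallyChaotic T) : LiYorkeChaotic T := by
  obtain ⟨Γ, ε, hΓ, hε, h⟩ := h
  refine ⟨Γ, hΓ, fun x hx y hy hxy => ⟨?_, ?_⟩⟩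
  · refine le_antisymm (le_of_forall_gt_imp_ge_of_dense fun r hr => ?_) zero_le
    obtain ⟨δ, hδ, hδr⟩ : ∃ δ : ℝ, 0 < δ ∧ ENNReal.ofReal δ ≤ r := by
      rcases eq_or_ne r ∞ with rfl | hr'
      · exact ⟨1, one_pos, le_top⟩
      · exact ⟨r.toReal, ENNReal.toReal_pos hr.ne' hr', ENNReal.ofReal_toReal_le⟩
    refine liminf_le_of_frequently_le
      ((frequently_mem_of_upperDensity_eq_one (h δ hδ x hx y hy hxy).2).mono fun n hn => ?_)
    rw [edist_dist, dist_eq_norm]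
    exact (ENNReal.ofReal_le_ofReal (le_of_lt hn)).trans hδr
  · refine (ENNReal.ofReal_pos.2 hε).trans_le (le_limsup_of_frequently_le
      ((frequently_notMem_of_lowerDensity_eq_zero (h 1 one_pos x hx y hy hxy).1).mono
        fun n hn => ?_))
    rw [edist_dist, dist_eq_norm]
    exact ENNReal.ofReal_le_ofReal (not_lt.1 hn)

theorem TopologicallyMixing.topologicallyTransitive {T : E →L[ℂ] E}
    (h : TopologicallyMixing T) : TopologicallyTransitive T := fun U V hU hU' hV hV' =>
  let ⟨N, hN⟩ := h U V hU hU' hV hV'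
  ⟨N, hN N le_rfl⟩

theorem not_liYorkeChaotic_of_norm_le {T : E →L[ℂ] E} {K : ℝ≥0}
    (h : ∀ n x, ‖x‖ ≤ K * ‖(T ^ n) x‖) : ¬ LiYorkeChaotic T := by
  rintro ⟨Γ, hΓ, hT⟩
  refine hΓ (Set.Subsingleton.countable fun x hx y hy => ?_)
  by_contra hxy
  have h0 := (hT x hx y hy hxy).1
  have hle : ∀ n, edist x y ≤ K * edist ((T ^ n) x) ((T ^ n) y) := fun n => by
    have := h n (x - y)
    rw [map_sub, ← dist_eq_norm, ← dist_eq_norm] at this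
    rw [edist_nndist, edist_nndist]
    exact_mod_cast this
  have hpos : 0 < edist x y := edist_pos.2 hxy
  have hlt : liminf (fun n : ℕ => edist ((T ^ n) x) ((T ^ n) y)) atTop < edist x y / K := by
    rw [h0]
    exact ENNReal.div_pos hpos.ne' ENNReal.coe_ne_top
  obtain ⟨n, hn⟩ := (frequently_lt_of_liminf_lt (by isBoundedDefault) hlt).exists
  exact absurd (hle n) (not_le.2 (by rw [mul_comm]; exact ENNReal.mul_lt_of_lt_div hn))

theorem not_topologicallyTransitive_of_norm_le [Nontrivial E] {T : E →L[ℂ] E} {K : ℝ}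
    (h : ∀ n x, ‖(T ^ n) x‖ ≤ K * ‖x‖) : ¬ TopologicallyTransitive T := by
  intro hT
  have hK : 0 ≤ K := by
    obtain ⟨x, hx⟩ := exists_ne (0 : E)
    exact nonneg_of_mul_nonneg_left ((norm_nonneg _).trans (h 0 x)) (norm_pos_iff.2 hx)
  obtain ⟨x, hx⟩ := NormedSpace.exists_lt_norm ℂ E K
  obtain ⟨n, _, ⟨y, hy, rfl⟩, hy'⟩ := hT (Metric.ball 0 1) {z | K < ‖z‖} Metric.isOpen_ball
    ⟨0, by simp⟩ (isOpen_lt continuous_const continuous_norm) ⟨x, hx⟩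
  have h1 := h n y
  have h2 : ‖y‖ ≤ 1 := (mem_ball_zero_iff.1 hy).le
  have h3 : K < ‖(T ^ n) y‖ := hy'
  nlinarith

theorem topologicallyMixing_of_dense {T S : E →L[ℂ] E} (hTS : T * S = 1)
    (hT : Dense {u | Tendsto (fun n : ℕ => (T ^ n) u) atTop (𝓝 0)})
    (hS : Dense {u | Tendsto (fun n : ℕ => (S ^ n) u) atTop (𝓝 0)}) : TopologicallyMixing T := by
  intro U V hU hU' hV hV'
  obtain ⟨u, hTu, hu⟩ := hT.exists_mem_open hU hU'
  obtain ⟨v, hSv, hv⟩ := hS.exists_mem_open hV hV'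
  have hinv : ∀ n : ℕ, (T ^ n) ((S ^ n) v) = v := fun n => by
    have : T ^ n * S ^ n = 1 := by
      induction n with
      | zero => simp
      | succ n ih => rw [pow_succ, pow_succ', mul_assoc, ← mul_assoc T, hTS, one_mul, ih]
    rw [← mul_apply_eq_comp, this, one_apply_eq_self]
  have h1 : Tendsto (fun n : ℕ => u + (S ^ n) v) atTop (𝓝 u) := by
    simpa using tendsto_const_nhds.add hSv
  have h2 : Tendsto (fun n : ℕ => (T ^ n) (u + (S ^ n) v)) atTop (𝓝 v) := by
    simpa only [map_add, hinv, zero_add] using hTu.add_const v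
  obtain ⟨N, hN⟩ := eventually_atTop.1
    ((h1.eventually_mem (hU.mem_nhds hu)).and (h2.eventually_mem (hV.mem_nhds hv)))
  exact ⟨N, fun n hn => ⟨_, ⟨_, (hN n hn).1, rfl⟩, (hN n hn).2⟩⟩

/-- The orbit of `x` tends to `0` and is unbounded, each along times of upper density one. -/
def IsDistributionallyIrregular (T : E →L[ℂ] E) (x : E) : Prop :=
  (∀ δ : ℝ, 0 < δ → upperDensity {j : ℕ | ‖(T ^ j) x‖ < δ} = 1) ∧
    ∀ K : ℝ, lowerDensity {j : ℕ | ‖(T ^ j) x‖ < K} = 0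

theorem IsDistributionallyIrregular.add_smul {T : E →L[ℂ] E} {x y : E}
    (hx : IsDistributionallyIrregular T x) (hy : Tendsto (fun n : ℕ => (T ^ n) y) atTop (𝓝 0))
    {c : ℂ} (hc : c ≠ 0) : IsDistributionallyIrregular T (y + c • x) := by
  have hc' : 0 < ‖c‖ := norm_pos_iff.2 hc
  have hy' : ∀ r > (0 : ℝ), ∀ᶠ n : ℕ in atTop, ‖(T ^ n) y‖ < r := fun r hr =>
    (tendsto_zero_iff_norm_tendsto_zero.1 hy).eventually_lt_const hr
  refine ⟨fun δ hδ => ?_, fun K => ?_⟩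
  · refine upperDensity_eq_one_of_eventually_subset ?_ (hx.1 (δ / 2 / ‖c‖) (by positivity))
    filter_upwards [hy' (δ / 2) (by positivity)] with n hn hxn
    have h1 : ‖c‖ * ‖(T ^ n) x‖ < δ / 2 := by
      rw [mul_comm]; exact (lt_div_iff₀ hc').1 hxn
    have h2 := norm_add_le ((T ^ n) y) (c • (T ^ n) x)
    rw [norm_smul] at h2
    change ‖(T ^ n) (y + c • x)‖ < δ
    rw [map_add, map_smul]
    linarith
  · refine lowerDensity_eq_zero_of_eventually_subset ?_ (hx.2 ((K + 1) / ‖c‖))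
    filter_upwards [hy' 1 one_pos] with n hn hxn
    change ‖(T ^ n) (y + c • x)‖ < K at hxn
    change ‖(T ^ n) x‖ < (K + 1) / ‖c‖
    rw [map_add, map_smul] at hxn
    have h2 := norm_sub_le ((T ^ n) y + c • (T ^ n) x) ((T ^ n) y)
    rw [add_sub_cancel_left, norm_smul] at h2
    rw [lt_div_iff₀ hc', mul_comm]
    linarith

theorem IsDistributionallyIrregular.ne_zero {T : E →L[ℂ] E} {x : E}
    (hx : IsDistributionallyIrregular T x) : x ≠ 0 := by
  rintro rfl
  have := hx.2 1
  have h1 := lowerDensity_eq_one_of_eventually_mem (A := {j : ℕ | ‖(T ^ j) (0 : E)‖ < 1})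
    (Eventually.of_forall fun n => by simp)
  linarith

theorem lowerDensity_eq_zero_of_disjoint {A B : Set ℕ} (hAB : Disjoint A B)
    (hA : upperDensity A = 1) : lowerDensity B = 0 := by
  rw [upperDensity_eq_one_iff] at hA
  rw [lowerDensity_eq_zero_iff]
  intro r hr
  refine (hA (1 - r) (by linarith)).mono fun N hN => ?_
  have h1 := ncard_inter_Icc_div_le_one (A ∪ B) N
  have h2 : ((A ∪ B) ∩ Set.Icc 1 N).ncard = (A ∩ Set.Icc 1 N).ncard + (B ∩ Set.Icc 1 N).ncard := by
    rw [Set.union_inter_distrib_right]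
    exact Set.ncard_union_eq (hAB.mono Set.inter_subset_left Set.inter_subset_left)
      ((Set.finite_Icc 1 N).inter_of_right A) ((Set.finite_Icc 1 N).inter_of_right B)
  rw [h2, Nat.cast_add, add_div] at h1
  linarith

theorem isOpen_setOf_lt_ncard_div {X : Type*} [TopologicalSpace X] {O : ℕ → Set X}
    (hO : ∀ j, IsOpen (O j)) (r : ℝ) (N : ℕ) :
    IsOpen {x | r < (({j | x ∈ O j} ∩ Set.Icc 1 N).ncard : ℝ) / (N : ℝ)} := by
  rw [isOpen_iff_mem_nhds]
  intro x hx
  have hfin : ({j | x ∈ O j} ∩ Set.Icc 1 N).Finite := (Set.finite_Icc 1 N).inter_of_right _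
  filter_upwards [(biInter_mem hfin).2 fun j hj => (hO j).mem_nhds hj.1] with y hy
  refine lt_of_lt_of_le hx ?_
  have hle := Set.ncard_le_ncard (s := {j | x ∈ O j} ∩ Set.Icc 1 N)
    (t := {j | y ∈ O j} ∩ Set.Icc 1 N) (fun j hj => ⟨Set.mem_iInter₂.1 hy j hj, hj.2⟩)
    ((Set.finite_Icc 1 N).inter_of_right _)
  exact div_le_div_of_nonneg_right (by exact_mod_cast hle) N.cast_nonneg

/-- A Baire category argument: if for each index `i` a dense set of points eventually lies in the
open sets `O i j`, then some point lies in them, for every `i`, along times of upper density one. -/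
theorem exists_forall_upperDensity_eq_one {X ι : Type*} [TopologicalSpace X] [BaireSpace X]
    [Nonempty X] [Countable ι] {O : ι → ℕ → Set X} (hO : ∀ i j, IsOpen (O i j))
    (hd : ∀ i, Dense {x | ∀ᶠ j in atTop, x ∈ O i j}) :
    ∃ x, ∀ i, upperDensity {j | x ∈ O i j} = 1 := by
  let W : ι × ℕ → Set X := fun q => ⋃ N ≥ q.2,
    {x | 1 - 1 / ((q.2 : ℝ) + 1) < (({j | x ∈ O q.1 j} ∩ Set.Icc 1 N).ncard : ℝ) / (N : ℝ)}
  have hWo : ∀ q, IsOpen (W q) := fun q =>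
    isOpen_biUnion fun N _ => isOpen_setOf_lt_ncard_div (hO q.1) _ N
  have hWd : ∀ q, Dense (W q) := fun q => by
    refine (hd q.1).mono fun x hx => ?_
    have h1 : upperDensity {j | x ∈ O q.1 j} = 1 := by
      refine upperDensity_eq_one_of_eventually_subset (A := Set.univ) (hx.mono fun j hj _ => hj) ?_
      have h2 := lowerDensity_eq_one_of_eventually_mem (A := Set.univ) (by simp)
      refine (upperDensity_eq_one_iff _).2 fun r hr => Eventually.frequently ?_
      exact eventually_lt_of_lt_liminf (hr.trans_eq h2.symm) (isBoundedUnder_ge_ncard_div _)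
    obtain ⟨N, hN, hN'⟩ := (((upperDensity_eq_one_iff _).1 h1 (1 - 1 / ((q.2 : ℝ) + 1))
      (by linarith [Nat.one_div_pos_of_nat (α := ℝ) (n := q.2)])).and_eventually
        (eventually_ge_atTop q.2)).exists
    exact Set.mem_iUnion₂.2 ⟨N, hN', hN⟩
  obtain ⟨x, hx⟩ := (dense_iInter_of_isOpen hWo hWd).nonempty
  refine ⟨x, fun i => (upperDensity_eq_one_iff _).2 fun r hr => ?_⟩
  rw [frequently_atTop]
  intro m
  obtain ⟨k, hk⟩ := exists_nat_one_div_lt (sub_pos.2 hr)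
  obtain ⟨N, hN, hN'⟩ := Set.mem_iUnion₂.1 (Set.mem_iInter.1 hx (i, max m k))
  refine ⟨N, (le_max_left _ _).trans hN, lt_trans ?_ hN'⟩
  have : 1 / (((max m k : ℕ) : ℝ) + 1) ≤ 1 / ((k : ℝ) + 1) := by
    apply Nat.one_div_le_one_div (le_max_right _ _)
  dsimp only at *
  linarith

theorem exists_isDistributionallyIrregular [CompleteSpace E] {T : E →L[ℂ] E}
    (hT : Dense {u | Tendsto (fun n : ℕ => (T ^ n) u) atTop (𝓝 0)}) {ε : ℝ} (hε : 0 < ε)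
    (hexp : ∀ η > (0 : ℝ), ∃ u, ‖u‖ < η ∧ ∀ᶠ n : ℕ in atTop, ε ≤ ‖(T ^ n) u‖) :
    ∃ x, IsDistributionallyIrregular T x := by
  let O : ℕ ⊕ ℕ → ℕ → Set E := fun i j => match i with
    | .inl m => {x | ‖(T ^ j) x‖ < 1 / ((m : ℝ) + 1)}
    | .inr m => {x | (m : ℝ) < ‖(T ^ j) x‖}
  have hex := exists_forall_upperDensity_eq_one (O := O) (fun i j => ?_) (fun i => ?_)
  · obtain ⟨x, hx⟩ := hex
    refine ⟨x, fun δ hδ => ?_, fun K => ?_⟩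
    · obtain ⟨m, hm⟩ := exists_nat_one_div_lt hδ
      exact upperDensity_eq_one_of_eventually_subset
        (Eventually.of_forall fun j hj => lt_trans hj hm) (hx (.inl m))
    · obtain ⟨m, hm⟩ := exists_nat_ge K
      refine lowerDensity_eq_zero_of_disjoint (Set.disjoint_left.2 fun j hj hj' => ?_) (hx (.inr m))
      have h1 : (m : ℝ) < ‖(T ^ j) x‖ := hj
      have h2 : ‖(T ^ j) x‖ < K := hj'
      linarith
  · rcases i with m | m
    · exact isOpen_lt (T ^ j).continuous.norm continuous_const
    · exact isOpen_lt continuous_const (T ^ j).continuous.norm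
  · rcases i with m | m
    · refine hT.mono fun u hu => ?_
      exact (tendsto_zero_iff_norm_tendsto_zero.1 hu).eventually_lt_const (by positivity)
    · rw [Metric.dense_iff]
      intro z r hr
      obtain ⟨y, hyz, hy⟩ := Metric.dense_iff.1 hT z (r / 2) (by positivity)
      obtain ⟨c, hc⟩ : ∃ c : ℝ, (m + 1 : ℝ) = c * ε ∧ 0 < c :=
        ⟨(m + 1) / ε, by field_simp, by positivity⟩
      obtain ⟨u, hu, hTu⟩ := hexp (r / 2 / c) (by have := hc.2; positivity)
      refine ⟨y + (c : ℂ) • u, ?_, ?_⟩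
      · rw [Metric.mem_ball] at hyz ⊢
        have h1 : dist (y + (c : ℂ) • u) y < r / 2 := by
          rw [dist_eq_norm, add_sub_cancel_left, norm_smul, Complex.norm_real, Real.norm_eq_abs,
            abs_of_pos hc.2, mul_comm]
          exact (lt_div_iff₀ hc.2).1 hu
        linarith [dist_triangle (y + (c : ℂ) • u) y z]
      · filter_upwards [hTu,
          (tendsto_zero_iff_norm_tendsto_zero.1 hy).eventually_lt_const one_pos] with n hn hn'
        have h1 := norm_sub_le ((T ^ n) y + (c : ℂ) • (T ^ n) u) ((T ^ n) y)
        rw [add_sub_cancel_left, norm_smul, Complex.norm_real, Real.norm_eq_abs,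
          abs_of_pos hc.2] at h1
        have h2 := mul_le_mul_of_nonneg_left hn hc.2.le
        show (m : ℝ) < ‖(T ^ n) (y + (c : ℂ) • u)‖
        rw [map_add, map_smul]
        linarith [hc.1]

theorem IsDistributionallyIrregular.denselyDistributionallyChaotic
    [TopologicalSpace.SeparableSpace E] {T : E →L[ℂ] E} {x : E}
    (hx : IsDistributionallyIrregular T x)
    (hT : Dense {u | Tendsto (fun n : ℕ => (T ^ n) u) atTop (𝓝 0)}) :
    DenselyDistributionallyChaotic T := by
  obtain ⟨D, hDs, hDc, hD⟩ := hT.exists_countable_dense_subset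
  obtain ⟨d, hd⟩ := hDc.exists_eq_range hD.nonempty
  have hd0 : ∀ k, Tendsto (fun n : ℕ => (T ^ n) (d k)) atTop (𝓝 0) := fun k =>
    hDs (hd ▸ Set.mem_range_self k)
  let s : ℕ × ℕ → ℝ := fun q => 1 / ((Nat.pair q.1 q.2 : ℝ) + 1)
  have hs : Function.Injective s := fun q q' h => by
    have h1 : (Nat.pair q.1 q.2 : ℝ) = Nat.pair q'.1 q'.2 := by
      simpa [s] using h
    have h2 := Nat.pair_eq_pair.1 (Nat.cast_injective h1)
    exact Prod.ext h2.1 h2.2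
  let F : ℝ → E := Function.extend s (fun q => d q.1) 0
  have hF : ∀ t, Tendsto (fun n : ℕ => (T ^ n) (F t)) atTop (𝓝 0) := fun t => by
    by_cases ht : ∃ q, s q = t
    · obtain ⟨q, rfl⟩ := ht
      simpa only [F, hs.extend_apply] using hd0 q.1
    · simp [F, Function.extend_apply' _ _ _ ht]
  let G : ℝ → E := fun t => F t + (t : ℂ) • x
  have hG : ∀ t t', t ≠ t' → IsDistributionallyIrregular T (G t - G t') := fun t t' h => by
    have h1 : G t - G t' = (F t - F t') + ((t - t' : ℝ) : ℂ) • x := by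
      simp only [G, Complex.ofReal_sub, sub_smul]; abel
    rw [h1]
    refine hx.add_smul ?_ (by exact_mod_cast sub_ne_zero.2 h)
    simpa only [map_sub, sub_zero] using (hF t).sub (hF t')
  have hGinj : Function.Injective G := fun t t' h => by
    by_contra hne
    exact (hG t t' hne).ne_zero (sub_eq_zero.2 h)
  refine ⟨Set.range G, 1, ?_, ?_, one_pos, ?_⟩
  · rw [Metric.dense_iff]
    intro z r hr
    obtain ⟨y, hyz, hy⟩ := Metric.dense_iff.1 hD z (r / 2) (by positivity)
    obtain ⟨k, rfl⟩ : ∃ k, d k = y := by rw [hd] at hy; exact hy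
    obtain ⟨j, hj⟩ := exists_nat_one_div_lt (show 0 < r / 2 / (‖x‖ + 1) by positivity)
    refine ⟨_, ?_, s (k, j), rfl⟩
    have h1 : s (k, j) ≤ 1 / ((j : ℝ) + 1) :=
      Nat.one_div_le_one_div (Nat.right_le_pair k j)
    have h0 : 0 ≤ s (k, j) := by positivity
    have h2 : dist (G (s (k, j))) (d k) < r / 2 := by
      simp only [G, F, hs.extend_apply]
      rw [dist_eq_norm, add_sub_cancel_left, norm_smul, Complex.norm_real, Real.norm_eq_abs,
        abs_of_nonneg h0]
      have h3 := (lt_div_iff₀ (by positivity)).1 (h1.trans_lt hj)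
      nlinarith [norm_nonneg x]
    rw [Metric.mem_ball] at hyz ⊢
    linarith [dist_triangle (G (s (k, j))) (d k) z]
  · intro hcount
    exact Set.not_countable_univ (Set.countable_of_injective_of_countable_image
      (s := (Set.univ : Set ℝ)) hGinj.injOn (by rwa [Set.image_univ]))
  · rintro δ hδ _ ⟨t, rfl⟩ _ ⟨t', rfl⟩ hne
    have h := hG t t' fun h => hne (h ▸ rfl)
    simp only [← map_sub]
    exact ⟨h.2 1, h.1 δ hδ⟩

end Operators

/-! ### Composition operators: iterates and norms -/

section CompositionLemmas

variable {X : Type*} [MeasurableSpace X] {μ : Measure X} {ψ χ : X → X}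

theorem IsInducingMap.id : IsInducingMap μ (id : X → X) :=
  ⟨measurable_id, 1, one_pos, fun B _ => by simp⟩

theorem IsInducingMap.comp (hψ : IsInducingMap μ ψ) (hχ : IsInducingMap μ χ) :
    IsInducingMap μ (ψ ∘ χ) := by
  obtain ⟨hψm, c, hc, hψc⟩ := hψ
  obtain ⟨hχm, d, hd, hχd⟩ := hχ
  refine ⟨hψm.comp hχm, d * c, mul_pos hd hc, fun B hB => ?_⟩
  rw [Set.preimage_comp, ENNReal.coe_mul, mul_assoc]
  exact (hχd _ (hψm hB)).trans (by gcongr; exact hψc B hB)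

theorem IsInducingMap.iterate (h : IsInducingMap μ ψ) (n : ℕ) : IsInducingMap μ ψ^[n] := by
  induction n with
  | zero => exact IsInducingMap.id
  | succ n ih => exact ih.comp h

variable (p : ℝ≥0∞) [Fact (1 ≤ p)] (hp : p ≠ ∞)

theorem compositionOperator_pow_toLp (h : IsInducingMap μ ψ) (n : ℕ) {f : X → ℂ}
    (hf : MemLp f p μ) :
    (compositionOperator p hp h ^ n) (hf.toLp f) =
      ((h.iterate n).memLp_comp hf).toLp (f ∘ ψ^[n]) := by
  induction n generalizing f with
  | zero => rfl
  | succ n ih =>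
    rw [pow_succ, mul_apply_eq_comp, compositionOperator_toLp, ih]
    exact MemLp.toLp_congr _ _ (by rw [Function.comp_assoc, Function.iterate_succ'])

theorem compositionOperator_pow (h : IsInducingMap μ ψ) (n : ℕ) :
    compositionOperator p hp h ^ n = compositionOperator p hp (h.iterate n) := by
  ext1 f
  rw [← Lp.toLp_coeFn f (Lp.memLp f), compositionOperator_pow_toLp, compositionOperator_toLp]

theorem compositionOperator_mul_eq_one (hψ : IsInducingMap μ ψ) (hχ : IsInducingMap μ χ)
    (hinv : Function.LeftInverse χ ψ) :
    compositionOperator p hp hψ * compositionOperator p hp hχ = 1 := by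
  ext1 f
  rw [← Lp.toLp_coeFn f (Lp.memLp f), mul_apply_eq_comp, compositionOperator_toLp,
    compositionOperator_toLp, one_apply_eq_self]
  exact MemLp.toLp_congr _ _ (by rw [Function.comp_assoc, hinv.comp_eq_id, Function.comp_id])

theorem norm_compositionOperator_le (h : IsInducingMap μ ψ) {c : ℝ≥0}
    (hc : ∀ B : Set X, MeasurableSet B → μ (ψ ⁻¹' B) ≤ c * μ B) (f : Lp ℂ p μ) :
    ‖compositionOperator p hp h f‖ ≤ (c ^ (1 / p).toReal : ℝ≥0) * ‖f‖ := by
  have hmap : μ.map ψ ≤ (c : ℝ≥0∞) • μ := Measure.le_iff.2 fun B hB => by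
    rw [Measure.map_apply h.1 hB]
    simpa using hc B hB
  have h1 := (Lp.memLp f).of_measure_le_smul ENNReal.coe_ne_top hmap
  have h2 : eLpNorm (f ∘ ψ) p μ ≤ (c ^ (1 / p).toReal : ℝ≥0) * eLpNorm f p μ := by
    rw [← eLpNorm_map_measure h1.1 h.1.aemeasurable]
    refine (eLpNorm_mono_measure f hmap).trans ?_
    rw [eLpNorm_smul_measure_of_ne_top hp, smul_eq_mul,
      ENNReal.coe_rpow_of_nonneg _ ENNReal.toReal_nonneg]
  have h3 := ENNReal.toReal_mono
    (ENNReal.mul_ne_top ENNReal.coe_ne_top (Lp.eLpNorm_ne_top f)) h2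
  rw [ENNReal.toReal_mul, ← Lp.norm_def] at h3
  exact (Lp.norm_toLp _ (h.memLp_comp (Lp.memLp f))).trans_le h3

theorem norm_compositionOperator_pow_indicatorConstLp [IsFiniteMeasure μ]
    (h : IsInducingMap μ ψ) (n : ℕ) {s : Set X} (hs : MeasurableSet s) (c : ℂ) :
    ‖(compositionOperator p hp h ^ n) (indicatorConstLp p hs (measure_ne_top μ s) c)‖ =
      ‖c‖ * μ.real (ψ^[n] ⁻¹' s) ^ (1 / p.toReal) := by
  have hp0 : p ≠ 0 := (zero_lt_one.trans_le (Fact.out : 1 ≤ p)).ne'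
  rw [indicatorConstLp, compositionOperator_pow_toLp,
    ← norm_indicatorConstLp hp0 hp (hs := (h.iterate n).1 hs) (hμs := measure_ne_top μ _)]
  rfl

end CompositionLemmas

/-! ### Composition operators whose symbol has an attracting point -/

theorem tendsto_measureReal_ball_zero {X : Type*} [MetricSpace X] [MeasurableSpace X]
    [BorelSpace X] {μ : Measure X} [IsProbabilityMeasure μ] [NullSingletonClass μ] (a : X) :
    Tendsto (fun n : ℕ => μ.real (Metric.ball a (1 / ((n : ℝ) + 1)))) atTop (𝓝 0) := by
  have hanti : Antitone fun n : ℕ => Metric.ball a (1 / ((n : ℝ) + 1)) := fun m n hmn =>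
    Metric.ball_subset_ball (Nat.one_div_le_one_div hmn)
  have h1 := tendsto_measure_iInter_atTop (μ := μ)
    (fun n : ℕ => (Metric.isOpen_ball (x := a)
      (ε := 1 / ((n : ℝ) + 1))).measurableSet.nullMeasurableSet)
    hanti ⟨0, measure_ne_top _ _⟩
  have h2 : ⋂ n : ℕ, Metric.ball a (1 / ((n : ℝ) + 1)) = {a} := by
    ext x
    simp only [Set.mem_iInter, Metric.mem_ball, Set.mem_singleton_iff]
    refine ⟨fun h => ?_, fun h n => by subst h; simpa using by positivity⟩
    by_contra hne
    obtain ⟨n, hn⟩ := exists_nat_one_div_lt (dist_pos.2 hne)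
    exact lt_asymm hn (h n)
  rw [h2, measure_singleton] at h1
  exact (ENNReal.tendsto_toReal ENNReal.zero_ne_top).comp h1

theorem tendsto_rpow_one_div_zero (p : ℝ≥0∞) [Fact (1 ≤ p)] (hp : p ≠ ∞) {f : ℕ → ℝ}
    (hf : Tendsto f atTop (𝓝 0)) :
    Tendsto (fun n => f n ^ (1 / p.toReal)) atTop (𝓝 0) := by
  have hp' : 0 < 1 / p.toReal := one_div_pos.2
    (ENNReal.toReal_pos (zero_lt_one.trans_le (Fact.out : 1 ≤ p)).ne' hp)
  have h := hf.rpow_const (p := 1 / p.toReal) (Or.inr hp'.le)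
  rwa [Real.zero_rpow hp'.ne'] at h

section Attracting

variable {X : Type*} [MetricSpace X] [SecondCountableTopology X] [MeasurableSpace X] [BorelSpace X]
  {μ : Measure X} [IsProbabilityMeasure μ] {ψ : X → X} {a : X}

theorem tendsto_measureReal_iterate_preimage_compl_ball (h : Measurable ψ)
    (ha : ∀ᵐ x ∂μ, Tendsto (fun n : ℕ => ψ^[n] x) atTop (𝓝 a)) {r : ℝ} (hr : 0 < r) :
    Tendsto (fun n : ℕ => μ.real (ψ^[n] ⁻¹' (Metric.ball a r)ᶜ)) atTop (𝓝 0) := by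
  have h1 := tendstoInMeasure_of_tendsto_ae (g := fun _ => a)
    (fun n => (h.iterate n).aestronglyMeasurable) ha (ENNReal.ofReal r) (ENNReal.ofReal_pos.2 hr)
  have h2 := (ENNReal.tendsto_toReal ENNReal.zero_ne_top).comp h1
  refine h2.congr fun n => ?_
  simp only [Function.comp_apply, Measure.real]
  congr 2
  ext x
  simp [edist_dist, ENNReal.ofReal_le_ofReal_iff dist_nonneg]

variable [NullSingletonClass μ] (p : ℝ≥0∞) [Fact (1 ≤ p)] (hp : p ≠ ∞)

theorem dense_tendsto_compositionOperator_pow_zero (h : IsInducingMap μ ψ)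
    (ha : ∀ᵐ x ∂μ, Tendsto (fun n : ℕ => ψ^[n] x) atTop (𝓝 a)) :
    Dense {u | Tendsto (fun n : ℕ => (compositionOperator p hp h ^ n) u) atTop (𝓝 0)} := by
  have hp0 : p ≠ 0 := (zero_lt_one.trans_le (Fact.out : 1 ≤ p)).ne'
  let Y : AddSubgroup (Lp ℂ p μ) :=
    { carrier := {u | Tendsto (fun n : ℕ => (compositionOperator p hp h ^ n) u) atTop (𝓝 0)}
      zero_mem' := by simp
      add_mem' := fun {u v} hu hv => by
        change Tendsto _ _ _
        simpa only [map_add, add_zero] using Tendsto.add hu hv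
      neg_mem' := fun {u} hu => by
        change Tendsto _ _ _
        simpa only [map_neg, neg_zero] using Tendsto.neg hu }
  have hY : ∀ u : Lp ℂ p μ, u ∈ Y.topologicalClosure := by
    refine Lp.induction hp _ (fun c s hs hμs => ?_) (fun f g hf hg _ h1 h2 => add_mem h1 h2)
      Y.isClosed_topologicalClosure
    rw [Lp.simpleFunc.coe_indicatorConst]
    let t : ℕ → Set X := fun k => s \ Metric.ball a (1 / ((k : ℝ) + 1))
    have ht : ∀ k, MeasurableSet (t k) := fun k => hs.diff Metric.isOpen_ball.measurableSet
    refine mem_closure_of_tendsto (b := atTop)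
      (f := fun k => indicatorConstLp p (ht k) (measure_ne_top μ _) c) ?_
      (Eventually.of_forall fun k => ?_)
    · rw [tendsto_iff_dist_tendsto_zero]
      have h3 := (tendsto_rpow_one_div_zero p hp (tendsto_measureReal_ball_zero (μ := μ) a)).const_mul
        ‖c‖
      rw [mul_zero] at h3
      refine squeeze_zero (fun _ => dist_nonneg) (fun k => ?_) h3
      rw [dist_indicatorConstLp_eq_norm, norm_indicatorConstLp hp0 hp]
      gcongr
      · exact measure_ne_top _ _
      · intro x hx
        rcases hx with ⟨⟨h4, -⟩, h5⟩ | ⟨h4, h5⟩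
        · exact absurd h4 h5
        · by_contra h6
          exact h5 ⟨h4, h6⟩
    · show Tendsto _ _ _
      rw [tendsto_zero_iff_norm_tendsto_zero]
      simp_rw [norm_compositionOperator_pow_indicatorConstLp]
      have h3 := (tendsto_rpow_one_div_zero p hp (tendsto_measureReal_iterate_preimage_compl_ball
        h.1 ha (Nat.one_div_pos_of_nat (n := k)))).const_mul ‖c‖
      rw [mul_zero] at h3
      refine squeeze_zero (fun n => by positivity) (fun n => ?_) h3
      gcongr
      · exact measure_ne_top _ _
      · exact fun x hx => hx.2
  exact fun u => hY u

theorem exists_norm_lt_and_eventually_le_norm_compositionOperator_pow (h : IsInducingMap μ ψ)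
    (ha : ∀ᵐ x ∂μ, Tendsto (fun n : ℕ => ψ^[n] x) atTop (𝓝 a)) {η : ℝ} (hη : 0 < η) :
    ∃ u, ‖u‖ < η ∧ ∀ᶠ n : ℕ in atTop, (1 / 2 : ℝ) ≤ ‖(compositionOperator p hp h ^ n) u‖ := by
  have hp0 : p ≠ 0 := (zero_lt_one.trans_le (Fact.out : 1 ≤ p)).ne'
  obtain ⟨k, hk⟩ := ((tendsto_rpow_one_div_zero p hp
    (tendsto_measureReal_ball_zero (μ := μ) a)).eventually_lt_const hη).exists
  have hB : MeasurableSet (Metric.ball a (1 / ((k : ℝ) + 1))) := Metric.isOpen_ball.measurableSet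
  refine ⟨indicatorConstLp p hB (measure_ne_top μ _) 1, ?_, ?_⟩
  · rw [norm_indicatorConstLp hp0 hp, norm_one, one_mul]
    exact hk
  · simp_rw [norm_compositionOperator_pow_indicatorConstLp, norm_one, one_mul]
    have h1 : Tendsto (fun n : ℕ => μ.real (ψ^[n] ⁻¹' Metric.ball a (1 / ((k : ℝ) + 1)))) atTop
        (𝓝 1) := by
      have h2 := (tendsto_measureReal_iterate_preimage_compl_ball h.1 ha
        (Nat.one_div_pos_of_nat (n := k))).const_sub 1
      rw [sub_zero] at h2
      refine h2.congr fun n => ?_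
      rw [Set.preimage_compl, probReal_compl_eq_one_sub ((h.iterate n).1 hB), sub_sub_cancel]
    have h3 := h1.rpow_const (p := 1 / p.toReal) (Or.inl one_ne_zero)
    rw [Real.one_rpow] at h3
    exact h3.eventually_const_le (by norm_num)

end Attracting

/-! ### Arc length measure and Lipschitz maps of the circle -/

section CircleMeasure

theorem circleMeasure_apply {B : Set Circle} (hB : MeasurableSet B) :
    circleMeasure B = (ENNReal.ofReal (2 * Real.pi))⁻¹ *
      volume (Circle.exp ⁻¹' B ∩ Set.Ioc (-Real.pi) Real.pi) := by
  have hexp : Measurable Circle.exp := Circle.exp.continuous.measurable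
  rw [circleMeasure, Measure.smul_apply, Measure.map_apply hexp hB,
    Measure.restrict_apply (hexp hB), smul_eq_mul]

instance : IsProbabilityMeasure circleMeasure := ⟨by
  have h2 : ENNReal.ofReal (2 * Real.pi) ≠ 0 := (ENNReal.ofReal_pos.2 Real.two_pi_pos).ne'
  rw [circleMeasure_apply MeasurableSet.univ, Set.preimage_univ, Set.univ_inter, Real.volume_Ioc,
    show Real.pi - -Real.pi = 2 * Real.pi by ring, ENNReal.inv_mul_cancel h2 ENNReal.ofReal_ne_top]⟩

theorem Circle.dist_exp_le (s t : ℝ) : dist (Circle.exp s) (Circle.exp t) ≤ dist s t := by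
  have h : dist (Circle.exp s) (Circle.exp t) = ‖(Circle.exp s : ℂ) - Circle.exp t‖ := by
    rw [← dist_eq_norm]; rfl
  rw [h, Circle.coe_exp, Circle.coe_exp, Real.dist_eq]
  have h1 : Complex.exp (s * Complex.I) - Complex.exp (t * Complex.I) =
      Complex.exp (t * Complex.I) * (Complex.exp (Complex.I * ((s - t : ℝ) : ℂ)) - 1) := by
    rw [mul_sub, ← Complex.exp_add]
    push_cast
    ring_nf
  rw [h1, norm_mul, Complex.norm_exp_ofReal_mul_I, one_mul]
  exact Real.norm_exp_I_mul_ofReal_sub_one_le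

theorem Circle.dist_le_dist_exp {s t : ℝ} (hst : s - t ∈ Set.Ioc (-Real.pi) Real.pi) :
    dist s t ≤ Real.pi / 2 * dist (Circle.exp s) (Circle.exp t) := by
  have h : dist (Circle.exp s) (Circle.exp t) = ‖(Circle.exp s : ℂ) - Circle.exp t‖ := by
    rw [← dist_eq_norm]; rfl
  have h1 := Complex.angle_le_mul_norm_sub (Circle.norm_coe (Circle.exp s))
    (Circle.norm_coe (Circle.exp t))
  rw [h, Real.dist_eq]
  refine le_of_eq_of_le ?_ h1
  rw [Circle.coe_exp, Circle.coe_exp, Complex.angle_exp_exp,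
    (toIocMod_eq_self Real.two_pi_pos).2]
  rwa [show -Real.pi + 2 * Real.pi = Real.pi by ring]

theorem hausdorffMeasure_le_volume_exp_preimage (B : Set Circle) :
    μH[1] B ≤ volume (Circle.exp ⁻¹' B ∩ Set.Ioc (-Real.pi) Real.pi) := by
  have hlip : LipschitzWith 1 Circle.exp := LipschitzWith.of_dist_le_mul fun s t => by
    simpa using Circle.dist_exp_le s t
  have hB : B ⊆ Circle.exp '' (Circle.exp ⁻¹' B ∩ Set.Ioc (-Real.pi) Real.pi) := fun z hz =>
    ⟨Complex.arg z, ⟨by simpa using hz, Complex.arg_mem_Ioc _⟩, Circle.exp_arg z⟩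
  refine (measure_mono hB).trans ((hlip.hausdorffMeasure_image_le zero_le_one _).trans ?_)
  simp [hausdorffMeasure_real]

theorem volume_exp_preimage_inter_le {B : Set Circle} {I : Set ℝ}
    (hI : ∀ s ∈ I, ∀ t ∈ I, s - t ∈ Set.Ioc (-Real.pi) Real.pi) :
    volume (Circle.exp ⁻¹' B ∩ I) ≤ ENNReal.ofReal (Real.pi / 2) * μH[1] B := by
  let f : ℝ → Circle := Circle.exp
  have hinj : Set.InjOn f I := fun s hs t ht hst => by
    have h := Circle.dist_le_dist_exp (hI s hs t ht)
    rw [show Circle.exp s = Circle.exp t from hst, dist_self, mul_zero] at h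
    exact dist_le_zero.1 h
  let g := Function.invFunOn f I
  have hg : ∀ s ∈ I, g (f s) = s := hinj.leftInvOn_invFunOn
  have hlip : LipschitzOnWith (Real.toNNReal (Real.pi / 2)) g (f '' I) := by
    refine LipschitzOnWith.of_dist_le_mul ?_
    rintro _ ⟨s, hs, rfl⟩ _ ⟨t, ht, rfl⟩
    rw [hg s hs, hg t ht, Real.coe_toNNReal _ (by positivity)]
    exact Circle.dist_le_dist_exp (hI s hs t ht)
  have hsub : Circle.exp ⁻¹' B ∩ I ⊆ g '' (B ∩ f '' I) := fun s hs =>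
    ⟨f s, ⟨hs.1, s, hs.2, rfl⟩, hg s hs.2⟩
  rw [← hausdorffMeasure_real]
  refine (measure_mono hsub).trans
    (((hlip.mono Set.inter_subset_right).hausdorffMeasure_image_le zero_le_one).trans ?_)
  rw [ENNReal.rpow_one]
  exact mul_le_mul_right (measure_mono Set.inter_subset_left) _

theorem volume_exp_preimage_le_hausdorffMeasure (B : Set Circle) :
    volume (Circle.exp ⁻¹' B ∩ Set.Ioc (-Real.pi) Real.pi) ≤
      ENNReal.ofReal Real.pi * μH[1] B := by
  have hsplit : Set.Ioc (-Real.pi) Real.pi = Set.Ioc (-Real.pi) 0 ∪ Set.Ioc 0 Real.pi :=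
    (Set.Ioc_union_Ioc_eq_Ioc (by linarith [Real.pi_pos]) Real.pi_pos.le).symm
  rw [hsplit, Set.inter_union_distrib_left]
  refine (measure_union_le _ _).trans ((add_le_add
    (volume_exp_preimage_inter_le fun s hs t ht => ?_)
    (volume_exp_preimage_inter_le fun s hs t ht => ?_)).trans_eq ?_)
  · exact ⟨by linarith [hs.1, ht.2], by linarith [hs.2, ht.1]⟩
  · exact ⟨by linarith [hs.1, ht.2], by linarith [hs.2, ht.1]⟩
  · rw [← add_mul, ← ENNReal.ofReal_add (by positivity) (by positivity), add_halves]

theorem circleMeasure_preimage_le {φ ψ : Circle → Circle} (hφ : Measurable φ)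
    (hψ : Function.LeftInverse ψ φ) {L : ℝ≥0} (hL : LipschitzWith L ψ) {B : Set Circle}
    (hB : MeasurableSet B) :
    circleMeasure (φ ⁻¹' B) ≤ (Real.toNNReal Real.pi * L : ℝ≥0) * circleMeasure B := by
  have hsub : φ ⁻¹' B ⊆ ψ '' B := fun z hz => ⟨φ z, hz, hψ z⟩
  have h1 : μH[1] (φ ⁻¹' B) ≤ L * μH[1] B := by
    refine (measure_mono hsub).trans ((hL.hausdorffMeasure_image_le zero_le_one B).trans_eq ?_)
    rw [ENNReal.rpow_one]
  rw [circleMeasure_apply (hφ hB), circleMeasure_apply hB, mul_left_comm]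
  refine mul_le_mul_right ?_ _
  calc _ ≤ ENNReal.ofReal Real.pi * μH[1] (φ ⁻¹' B) := volume_exp_preimage_le_hausdorffMeasure _
    _ ≤ ENNReal.ofReal Real.pi * (L * μH[1] B) := by gcongr
    _ ≤ ENNReal.ofReal Real.pi *
        (L * volume (Circle.exp ⁻¹' B ∩ Set.Ioc (-Real.pi) Real.pi)) := by
      gcongr
      exact hausdorffMeasure_le_volume_exp_preimage B
    _ = _ := by rw [ENNReal.coe_mul, mul_assoc]; rfl

instance : NullSingletonClass circleMeasure := ⟨fun z => by
  have h : volume (Circle.exp ⁻¹' {z} ∩ Set.Ioc (-Real.pi) Real.pi) = 0 := by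
    refine le_antisymm ((volume_exp_preimage_le_hausdorffMeasure _).trans ?_) zero_le
    have := Measure.nullSingletonClass_hausdorff Circle (d := 1) one_pos
    rw [measure_singleton, mul_zero]
  rw [circleMeasure_apply (measurableSet_singleton z), h, mul_zero]⟩

end CircleMeasure

/-! ### Möbius transformations of the disk -/

section Mobius

open ComplexConjugate Complex

/-- The disk automorphism `z ↦ (z - α) / (1 - conj α * z)`. -/
noncomputable def mobius (α : UnitDisc) (z : ℂ) : ℂ := (z - α) / (1 - conj (α : ℂ) * z)

theorem mobius_denom_norm_ge (α : UnitDisc) {z : ℂ} (hz : ‖z‖ ≤ 1) :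
    1 - ‖(α : ℂ)‖ ≤ ‖1 - conj (α : ℂ) * z‖ := by
  have h1 := norm_sub_norm_le (1 : ℂ) (conj (α : ℂ) * z)
  rw [norm_one, norm_mul, RCLike.norm_conj] at h1
  nlinarith [norm_nonneg (α : ℂ)]

theorem mobius_denom_ne_zero (α : UnitDisc) {z : ℂ} (hz : ‖z‖ ≤ 1) :
    1 - conj (α : ℂ) * z ≠ 0 := by
  rw [← norm_pos_iff]
  linarith [mobius_denom_norm_ge α hz, α.norm_lt_one]

theorem normSq_mobius_denom_sub (α z : ℂ) :
    normSq (1 - conj α * z) - normSq (z - α) = (1 - normSq α) * (1 - normSq z) := by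
  simp only [normSq_apply, sub_re, sub_im, mul_re, mul_im, conj_re, conj_im, one_re, one_im]
  ring

theorem one_sub_normSq_mobius (α : UnitDisc) {z : ℂ} (hz : ‖z‖ ≤ 1) :
    1 - normSq (mobius α z) =
      (1 - normSq α) * (1 - normSq z) / normSq (1 - conj (α : ℂ) * z) := by
  have h := normSq_pos.2 (mobius_denom_ne_zero α hz)
  rw [mobius, normSq_div, ← normSq_mobius_denom_sub, sub_div, div_self h.ne']

theorem norm_mobius_lt_one (α : UnitDisc) {z : ℂ} (hz : ‖z‖ < 1) : ‖mobius α z‖ < 1 := by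
  have h1 : normSq z < 1 := by
    rw [normSq_eq_norm_sq]; nlinarith [norm_nonneg z]
  have h2 : 0 < 1 - normSq (mobius α z) := by
    rw [one_sub_normSq_mobius α hz.le]
    exact div_pos (mul_pos (sub_pos.2 α.normSq_lt_one) (sub_pos.2 h1))
      (normSq_pos.2 (mobius_denom_ne_zero α hz.le))
  rw [normSq_eq_norm_sq] at h2
  nlinarith [norm_nonneg (mobius α z)]

theorem norm_mobius_eq_one (α : UnitDisc) {z : ℂ} (hz : ‖z‖ = 1) : ‖mobius α z‖ = 1 := by
  have h2 := one_sub_normSq_mobius α hz.le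
  rw [normSq_eq_norm_sq z, hz, normSq_eq_norm_sq] at h2
  have h3 : ‖mobius α z‖ ^ 2 = 1 := by
    norm_num at h2
    linarith
  exact (pow_eq_one_iff_of_nonneg (norm_nonneg _) two_ne_zero).1 h3

theorem mobius_neg_mobius (α : UnitDisc) {z : ℂ} (hz : ‖z‖ ≤ 1) :
    mobius (-α) (mobius α z) = z := by
  have h1 := mobius_denom_ne_zero α hz
  have h2 : (1 : ℂ) - conj (α : ℂ) * α ≠ 0 := mobius_denom_ne_zero α α.norm_lt_one.le
  have h3 : (1 : ℂ) - conj (-(α : ℂ)) * ((z - α) / (1 - conj (α : ℂ) * z)) =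
      (1 - conj (α : ℂ) * α) / (1 - conj (α : ℂ) * z) := by
    rw [map_neg]
    field_simp
    ring
  have h4 : (z - α) / (1 - conj (α : ℂ) * z) - -(α : ℂ) =
      z * (1 - conj (α : ℂ) * α) / (1 - conj (α : ℂ) * z) := by
    rw [eq_div_iff h1, sub_mul, div_mul_cancel₀ _ h1]
    ring
  rw [mobius, mobius, UnitDisc.coe_neg, h3, h4, div_div_div_cancel_right₀ h1,
    mul_div_assoc, div_self h2, mul_one]

theorem mobius_self (α : UnitDisc) : mobius α α = 0 := by simp [mobius]

theorem mobius_zero_left (z : ℂ) : mobius 0 z = z := by simp [mobius]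

theorem differentiableAt_mobius (α : UnitDisc) {z : ℂ} (hz : ‖z‖ ≤ 1) :
    DifferentiableAt ℂ (mobius α) z := by
  unfold mobius
  exact DifferentiableAt.div (by fun_prop) (by fun_prop) (mobius_denom_ne_zero α hz)

theorem dist_mobius_le (α : UnitDisc) {z w : ℂ} (hz : ‖z‖ ≤ 1) (hw : ‖w‖ ≤ 1) :
    dist (mobius α z) (mobius α w) ≤
      ‖(1 : ℂ) - conj (α : ℂ) * α‖ / (1 - ‖(α : ℂ)‖) ^ 2 * dist z w := by
  have h1 := mobius_denom_ne_zero α hz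
  have h2 := mobius_denom_ne_zero α hw
  have h3 : mobius α z - mobius α w = (1 - conj (α : ℂ) * α) * (z - w) /
      ((1 - conj (α : ℂ) * z) * (1 - conj (α : ℂ) * w)) := by
    rw [mobius, mobius, div_sub_div _ _ h1 h2]
    ring
  have h0 : 0 < 1 - ‖(α : ℂ)‖ := sub_pos.2 α.norm_lt_one
  rw [dist_eq_norm, dist_eq_norm, h3, norm_div, norm_mul, norm_mul, div_mul_eq_mul_div, pow_two]
  gcongr
  · exact mobius_denom_norm_ge α hz
  · exact mobius_denom_norm_ge α hw

theorem mapsTo_mobius_ball (α : UnitDisc) :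
    Set.MapsTo (mobius α) (Metric.ball 0 1) (Metric.ball 0 1) := fun z hz => by
  rw [mem_ball_zero_iff] at hz ⊢
  exact norm_mobius_lt_one α hz

theorem differentiableOn_mobius (α : UnitDisc) :
    DifferentiableOn ℂ (mobius α) (Metric.ball 0 1) := fun _ hz =>
  (differentiableAt_mobius α (mem_ball_zero_iff.1 hz).le).differentiableWithinAt

/-- A complex number of norm one as a point of the circle. -/
noncomputable def Circle.ofNormEqOne (w : ℂ) (hw : ‖w‖ = 1) : Circle :=
  ⟨w, mem_sphere_zero_iff_norm.2 hw⟩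

theorem Circle.coe_ofNormEqOne (w : ℂ) (hw : ‖w‖ = 1) : (Circle.ofNormEqOne w hw : ℂ) = w := rfl

/-- The restriction of a Möbius transformation to the unit circle. -/
noncomputable def mobiusCircle (α : UnitDisc) : Equiv.Perm Circle where
  toFun z := Circle.ofNormEqOne (mobius α z) (norm_mobius_eq_one α z.norm_coe)
  invFun z := Circle.ofNormEqOne (mobius (-α) z) (norm_mobius_eq_one (-α) z.norm_coe)
  left_inv z := Circle.ext (mobius_neg_mobius α z.norm_coe.le)
  right_inv z := Circle.ext (by
    simpa [Circle.coe_ofNormEqOne] using mobius_neg_mobius (-α) z.norm_coe.le)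

theorem coe_mobiusCircle (α : UnitDisc) (z : Circle) : (mobiusCircle α z : ℂ) = mobius α z := rfl

theorem mobiusCircle_inv (α : UnitDisc) : (mobiusCircle α)⁻¹ = mobiusCircle (-α) :=
  Equiv.ext fun _ => rfl

theorem exists_lipschitzWith_mobiusCircle (α : UnitDisc) :
    ∃ L : ℝ≥0, LipschitzWith L (mobiusCircle α) :=
  ⟨⟨‖(1 : ℂ) - conj (α : ℂ) * α‖ / (1 - ‖(α : ℂ)‖) ^ 2, by positivity⟩,
    LipschitzWith.of_dist_le_mul fun z w => dist_mobius_le α z.norm_coe.le w.norm_coe.le⟩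

theorem isometry_mulLeft_circle (c : Circle) : Isometry (Equiv.mulLeft c) :=
  Isometry.of_dist_eq fun z w => by
    change dist ((c * z : Circle) : ℂ) ((c * w : Circle) : ℂ) = dist (z : ℂ) w
    rw [dist_eq_norm, dist_eq_norm, Circle.coe_mul, Circle.coe_mul, ← mul_sub, norm_mul,
      Circle.norm_coe, one_mul]

/-! ### Disk automorphisms and their boundary maps -/

theorem exists_eq_mul_of_leftInverse {F G : ℂ → ℂ}
    (hF : DifferentiableOn ℂ F (Metric.ball 0 1)) (hG : DifferentiableOn ℂ G (Metric.ball 0 1))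
    (hFm : Set.MapsTo F (Metric.ball 0 1) (Metric.ball 0 1))
    (hGm : Set.MapsTo G (Metric.ball 0 1) (Metric.ball 0 1))
    (hGF : Set.LeftInvOn G F (Metric.ball 0 1)) (hF0 : F 0 = 0) :
    ∃ c : Circle, ∀ z ∈ Metric.ball (0 : ℂ) 1, F z = c * z := by
  have h0 : (0 : ℂ) ∈ Metric.ball (0 : ℂ) 1 := Metric.mem_ball_self one_pos
  have hG0 : G 0 = 0 := by simpa [hF0] using hGF h0
  have hhalf : (1 / 2 : ℂ) ∈ Metric.ball (0 : ℂ) 1 := by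
    rw [mem_ball_zero_iff]; norm_num
  have h1 : ‖F (1 / 2)‖ = ‖(1 / 2 : ℂ)‖ := by
    refine le_antisymm (norm_le_norm_of_mapsTo_ball hF
      (hFm.mono_right Metric.ball_subset_closedBall) hF0 (mem_ball_zero_iff.1 hhalf)) ?_
    have := norm_le_norm_of_mapsTo_ball hG (hGm.mono_right Metric.ball_subset_closedBall) hG0
      (mem_ball_zero_iff.1 (hFm hhalf))
    rwa [hGF hhalf] at this
  obtain ⟨c, hc, hFc⟩ := affine_of_mapsTo_ball_of_exists_norm_dslope_eq_div' (R₂ := 1) hF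
    (by rw [hF0]; exact hFm.mono_right Metric.ball_subset_closedBall)
    ⟨1 / 2, hhalf, by
      rw [dslope_of_ne _ (by norm_num), slope_def_field, hF0, sub_zero, sub_zero, norm_div, h1]
      norm_num⟩
  rw [div_one] at hc
  refine ⟨Circle.ofNormEqOne c hc, fun z hz => ?_⟩
  rw [hFc hz, Circle.coe_ofNormEqOne]
  simp only [hF0, zero_add, sub_zero, smul_eq_mul, mul_comm]

theorem IsDiskAutomorphism.exists_eq_mobius {φ : ℂ → ℂ} (hφ : IsDiskAutomorphism φ)
    {z₀ w₀ : UnitDisc} (hw : φ z₀ = w₀) :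
    ∃ c : Circle, ∀ z ∈ Metric.ball (0 : ℂ) 1, φ z = mobius (-w₀) (c * mobius z₀ z) := by
  obtain ⟨hd, hm, g, hgd, hgm, hgφ, -⟩ := hφ
  have hle : ∀ {z : ℂ}, z ∈ Metric.ball (0 : ℂ) 1 → ‖z‖ ≤ 1 := fun hz =>
    (mem_ball_zero_iff.1 hz).le
  have hinv : ∀ α : UnitDisc, ∀ z ∈ Metric.ball (0 : ℂ) 1, mobius α (mobius (-α) z) = z :=
    fun α z hz => by simpa using mobius_neg_mobius (-α) (hle hz)
  obtain ⟨c, hc⟩ := exists_eq_mul_of_leftInverse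
    (F := mobius w₀ ∘ φ ∘ mobius (-z₀)) (G := mobius z₀ ∘ g ∘ mobius (-w₀))
    ((differentiableOn_mobius w₀).comp (hd.comp (differentiableOn_mobius _) (mapsTo_mobius_ball _))
      (hm.comp (mapsTo_mobius_ball _)))
    ((differentiableOn_mobius z₀).comp (hgd.comp (differentiableOn_mobius _) (mapsTo_mobius_ball _))
      (hgm.comp (mapsTo_mobius_ball _)))
    ((mapsTo_mobius_ball _).comp (hm.comp (mapsTo_mobius_ball _)))
    ((mapsTo_mobius_ball _).comp (hgm.comp (mapsTo_mobius_ball _)))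
    (fun z hz => by
      have h1 := mapsTo_mobius_ball (-z₀) hz
      simp only [Function.comp_apply]
      rw [mobius_neg_mobius w₀ (hle (hm h1)), hgφ h1, hinv z₀ z hz])
    (by
      have : mobius (-z₀) 0 = z₀ := by simp [mobius]
      simp only [Function.comp_apply]
      rw [this, hw, mobius_self])
  refine ⟨c, fun z hz => ?_⟩
  have h1 := hc _ (mapsTo_mobius_ball z₀ hz)
  simp only [Function.comp_apply] at h1
  rw [mobius_neg_mobius z₀ (hle hz)] at h1
  rw [← h1, mobius_neg_mobius w₀ (hle (hm hz))]

instance nhdsWithin_ball_neBot (ζ : Circle) : (𝓝[Metric.ball 0 1] (ζ : ℂ)).NeBot := by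
  rw [← mem_closure_iff_nhdsWithin_neBot, closure_ball (0 : ℂ) one_ne_zero,
    mem_closedBall_zero_iff]
  exact ζ.norm_coe.le

theorem HasBoundaryValue.boundaryMap_eq {φ : ℂ → ℂ} {ζ w : Circle} (h : HasBoundaryValue φ ζ w) :
    boundaryMap φ ζ = w := by
  have hex : ∃ w : Circle, HasBoundaryValue φ ζ w := ⟨w, h⟩
  rw [boundaryMap, dif_pos hex]
  exact Circle.ext (tendsto_nhds_unique hex.choose_spec h)

theorem hasBoundaryValue_of_eqOn_mobius {φ : ℂ → ℂ} {z₀ w₀ : UnitDisc} {c : Circle}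
    (hφ : ∀ z ∈ Metric.ball (0 : ℂ) 1, φ z = mobius (-w₀) (c * mobius z₀ z)) (ζ : Circle) :
    HasBoundaryValue φ ζ (((mobiusCircle w₀)⁻¹ * Equiv.mulLeft c * mobiusCircle z₀) ζ) := by
  have hcont : ContinuousAt (fun z : ℂ => mobius (-w₀) (c * mobius z₀ z)) ζ := by
    refine ContinuousAt.comp (g := mobius (-w₀)) ?_
      (continuousAt_const.mul (differentiableAt_mobius z₀ ζ.norm_coe.le).continuousAt)
    refine (differentiableAt_mobius _ ?_).continuousAt
    rw [norm_mul, Circle.norm_coe, norm_mobius_eq_one z₀ ζ.norm_coe, one_mul]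
  exact (hcont.tendsto.mono_left nhdsWithin_le_nhds).congr'
    (eventually_nhdsWithin_of_forall fun z hz => (hφ z hz).symm)

theorem boundaryMap_eq_of_eqOn_mobius {φ : ℂ → ℂ} {z₀ w₀ : UnitDisc} {c : Circle}
    (hφ : ∀ z ∈ Metric.ball (0 : ℂ) 1, φ z = mobius (-w₀) (c * mobius z₀ z)) :
    boundaryMap φ = ((mobiusCircle w₀)⁻¹ * Equiv.mulLeft c * mobiusCircle z₀ : Equiv.Perm Circle) :=
  funext fun ζ => (hasBoundaryValue_of_eqOn_mobius hφ ζ).boundaryMap_eq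

end Mobius

/-! ### Bi-Lipschitz permutations of the circle -/

theorem isInducingMap_of_lipschitzWith {Φ : Equiv.Perm Circle} {K L : ℝ≥0}
    (hK : LipschitzWith K Φ) (hL : LipschitzWith L ⇑Φ⁻¹) : IsInducingMap circleMeasure Φ := by
  refine ⟨hK.continuous.measurable, Real.toNNReal Real.pi * L + 1, by positivity, fun B hB => ?_⟩
  refine (circleMeasure_preimage_le hK.continuous.measurable (Φ.left_inv) hL hB).trans ?_
  gcongr
  exact le_self_add

section Elliptic

variable (p : ℝ≥0∞) [Fact (1 ≤ p)] (hp : p ≠ ∞) {Φ : Equiv.Perm Circle} {L : ℝ≥0}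

theorem norm_compositionOperator_pow_le_of_lipschitzWith
    (hL : ∀ n : ℕ, LipschitzWith L ⇑(Φ⁻¹ ^ n)) (h : IsInducingMap circleMeasure Φ)
    (n : ℕ) (f : Lp ℂ p circleMeasure) :
    ‖(compositionOperator p hp h ^ n) f‖ ≤
      ((Real.toNNReal Real.pi * L) ^ (1 / p).toReal : ℝ≥0) * ‖f‖ := by
  rw [compositionOperator_pow]
  refine norm_compositionOperator_le p hp _ (fun B hB => ?_) f
  refine circleMeasure_preimage_le (h.iterate n).1 (fun z => ?_) (hL n) hB
  rw [Equiv.Perm.iterate_eq_pow, inv_pow, ← Equiv.Perm.mul_apply, inv_mul_cancel,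
    Equiv.Perm.one_apply]

theorem norm_le_norm_compositionOperator_pow_of_lipschitzWith
    (hL : ∀ n : ℕ, LipschitzWith L ⇑(Φ ^ n)) (h : IsInducingMap circleMeasure Φ)
    (h' : IsInducingMap circleMeasure ⇑Φ⁻¹) (n : ℕ) (f : Lp ℂ p circleMeasure) :
    ‖f‖ ≤ ((Real.toNNReal Real.pi * L) ^ (1 / p).toReal : ℝ≥0) *
      ‖(compositionOperator p hp h ^ n) f‖ := by
  have hinv : compositionOperator p hp h' ^ n * compositionOperator p hp h ^ n = 1 := by
    rw [compositionOperator_pow, compositionOperator_pow]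
    refine compositionOperator_mul_eq_one p hp _ _ fun z => ?_
    rw [Equiv.Perm.iterate_eq_pow, Equiv.Perm.iterate_eq_pow, inv_pow,
      ← Equiv.Perm.mul_apply, mul_inv_cancel, Equiv.Perm.one_apply]
  have h1 := norm_compositionOperator_pow_le_of_lipschitzWith p hp (Φ := Φ⁻¹) (by simpa using hL) h'
    n ((compositionOperator p hp h ^ n) f)
  rwa [← mul_apply_eq_comp, hinv, one_apply_eq_self] at h1

instance : Nontrivial (Lp ℂ p circleMeasure) := by
  have hp1 : (1 : ℝ≥0∞) ≤ p := Fact.out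
  refine ⟨indicatorConstLp p MeasurableSet.univ (measure_ne_top _ _) 1, 0, fun h => ?_⟩
  have h1 := norm_indicatorConstLp' (μ := circleMeasure) (p := p) (hs := MeasurableSet.univ)
    (hμs := measure_ne_top _ _) (c := (1 : ℂ)) (zero_lt_one.trans_le hp1).ne' (by simp)
  rw [h] at h1
  simp at h1

end Elliptic

/-! ### Boundary dynamics of disk automorphisms without interior fixed points -/

section Dynamics

open ComplexConjugate Complex

/-- The coordinate `a / (a - z)` sends `a` to infinity and the rest of the circle to the line
`re = 1 / 2`. -/
noncomputable def lineCoord (a z : Circle) : ℂ := a / (a - z)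

theorem lineCoord_ne_zero {a z : Circle} (h : z ≠ a) : lineCoord a z ≠ 0 :=
  div_ne_zero a.coe_ne_zero (sub_ne_zero.2 fun h' => h (Circle.ext h'.symm))

theorem coe_eq_sub_div_lineCoord (a z : Circle) : (z : ℂ) = a - a / lineCoord a z := by
  rw [lineCoord, div_div_cancel₀ a.coe_ne_zero, sub_sub_cancel]

theorem Circle.tendsto_iff_coe {u : ℕ → Circle} {b : Circle} :
    Tendsto u atTop (𝓝 b) ↔ Tendsto (fun n => (u n : ℂ)) atTop (𝓝 (b : ℂ)) :=
  Topology.IsEmbedding.subtypeVal.tendsto_nhds_iff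

variable {a : Circle} {Φ : Equiv.Perm Circle}

theorem iterate_ne_of_fixed (ha : Φ a = a) {z : Circle} (hz : z ≠ a) (n : ℕ) : Φ^[n] z ≠ a :=
  fun h => hz (Φ.injective.iterate n (h.trans (Function.iterate_fixed ha n).symm))

theorem lineCoord_iterate_mul {k : ℝ} {u₀ : ℂ} (ha : Φ a = a)
    (h : ∀ z, z ≠ a → lineCoord a (Φ z) - u₀ = k * (lineCoord a z - u₀)) {z : Circle} (hz : z ≠ a)
    (n : ℕ) : lineCoord a (Φ^[n] z) - u₀ = (k : ℂ) ^ n * (lineCoord a z - u₀) := by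
  induction n with
  | zero => simp
  | succ n ih =>
    rw [Function.iterate_succ_apply', h _ (iterate_ne_of_fixed ha hz n), ih, pow_succ']
    ring

theorem tendsto_iterate_of_tendsto_lineCoord_norm {z : Circle}
    (h : Tendsto (fun n : ℕ => ‖lineCoord a (Φ^[n] z)‖) atTop atTop) :
    Tendsto (fun n : ℕ => Φ^[n] z) atTop (𝓝 a) := by
  rw [Circle.tendsto_iff_coe]
  have h1 : Tendsto (fun n : ℕ => (a : ℂ) / lineCoord a (Φ^[n] z)) atTop (𝓝 0) := by
    rw [tendsto_zero_iff_norm_tendsto_zero]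
    simp_rw [norm_div, Circle.norm_coe]
    simpa only [one_div, Function.comp_def] using tendsto_inv_atTop_zero.comp h
  have h2 := h1.const_sub (a : ℂ)
  rw [sub_zero] at h2
  exact h2.congr fun n => (coe_eq_sub_div_lineCoord _ _).symm

theorem tendsto_iterate_of_lt_one {k : ℝ} {b : Circle} (hb : b ≠ a) (hk0 : 0 < k) (hk : k < 1)
    (ha : Φ a = a)
    (h : ∀ z, z ≠ a → lineCoord a (Φ z) - lineCoord a b = k * (lineCoord a z - lineCoord a b))
    {z : Circle} (hz : z ≠ a) : Tendsto (fun n : ℕ => Φ^[n] z) atTop (𝓝 b) := by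
  rw [Circle.tendsto_iff_coe]
  have h1 : Tendsto (fun n : ℕ => lineCoord a (Φ^[n] z)) atTop (𝓝 (lineCoord a b)) := by
    have h2 : Tendsto (fun n : ℕ => (k : ℂ) ^ n) atTop (𝓝 0) :=
      tendsto_pow_atTop_nhds_zero_of_norm_lt_one (by
        rw [Complex.norm_real, Real.norm_eq_abs, abs_of_pos hk0]; exact hk)
    have h3 := (h2.mul_const (lineCoord a z - lineCoord a b)).add_const (lineCoord a b)
    rw [zero_mul, zero_add] at h3
    exact h3.congr fun n => by rw [← lineCoord_iterate_mul ha h hz n, sub_add_cancel]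
  have h4 : Tendsto (fun n : ℕ => (a : ℂ) - a / lineCoord a (Φ^[n] z)) atTop
      (𝓝 (a - a / lineCoord a b)) :=
    (tendsto_const_nhds.div h1 (lineCoord_ne_zero hb)).const_sub _
  rw [← coe_eq_sub_div_lineCoord a b] at h4
  exact h4.congr fun n => (coe_eq_sub_div_lineCoord _ _).symm

theorem tendsto_iterate_of_one_lt {k : ℝ} {b : Circle} (hk : 1 < k)
    (ha : Φ a = a)
    (h : ∀ z, z ≠ a → lineCoord a (Φ z) - lineCoord a b = k * (lineCoord a z - lineCoord a b))
    {z : Circle} (hz : z ≠ a) (hzb : z ≠ b) : Tendsto (fun n : ℕ => Φ^[n] z) atTop (𝓝 a) := by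
  refine tendsto_iterate_of_tendsto_lineCoord_norm ?_
  have h0 : 0 < ‖lineCoord a z - lineCoord a b‖ := by
    rw [norm_pos_iff, sub_ne_zero]
    intro h'
    apply hzb
    apply Circle.ext
    rw [coe_eq_sub_div_lineCoord a z, h', ← coe_eq_sub_div_lineCoord a b]
  have h1 : Tendsto (fun n : ℕ => k ^ n * ‖lineCoord a z - lineCoord a b‖ - ‖lineCoord a b‖)
      atTop atTop :=
    tendsto_atTop_add_const_right _ _ ((tendsto_pow_atTop_atTop_of_one_lt hk).atTop_mul_const h0)
  refine tendsto_atTop_mono (fun n => ?_) h1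
  have h2 := congrArg norm (lineCoord_iterate_mul ha h hz n)
  rw [norm_mul, norm_pow, Complex.norm_real, Real.norm_eq_abs, abs_of_pos (by linarith)] at h2
  rw [← h2]
  linarith [norm_sub_le (lineCoord a (Φ^[n] z)) (lineCoord a b)]

theorem tendsto_iterate_of_translation {m : ℂ} (hm : m ≠ 0) (ha : Φ a = a)
    (h : ∀ z, z ≠ a → lineCoord a (Φ z) = lineCoord a z + m) (z : Circle) :
    Tendsto (fun n : ℕ => Φ^[n] z) atTop (𝓝 a) := by
  rcases eq_or_ne z a with rfl | hz
  · simp_rw [Function.iterate_fixed ha]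
    exact tendsto_const_nhds
  refine tendsto_iterate_of_tendsto_lineCoord_norm ?_
  have h1 : ∀ n : ℕ, lineCoord a (Φ^[n] z) = lineCoord a z + n * m := fun n => by
    induction n with
    | zero => simp
    | succ n ih =>
      rw [Function.iterate_succ_apply', h _ (iterate_ne_of_fixed ha hz n), ih]
      push_cast
      ring
  have h2 : Tendsto (fun n : ℕ => (n : ℝ) * ‖m‖ - ‖lineCoord a z‖) atTop atTop :=
    tendsto_atTop_add_const_right _ _
      (tendsto_natCast_atTop_atTop.atTop_mul_const (norm_pos_iff.2 hm))
  refine tendsto_atTop_mono (fun n => ?_) h2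
  have h3 := norm_sub_le (lineCoord a (Φ^[n] z)) (lineCoord a z)
  rw [h1 n, add_sub_cancel_left, norm_mul, Complex.norm_natCast] at h3
  rw [h1 n]
  linarith

/-- Off an exceptional pair of points, `Φ` has an attracting point and a repelling one. -/
def HasNorthSouthDynamics (Φ : Equiv.Perm Circle) : Prop :=
  ∃ a b : Circle, (∀ z, z ≠ a → z ≠ b → Tendsto (fun n : ℕ => Φ^[n] z) atTop (𝓝 a)) ∧
    ∀ z, z ≠ a → z ≠ b → Tendsto (fun n : ℕ => (⇑Φ⁻¹)^[n] z) atTop (𝓝 b)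

theorem Circle.perm_inv_apply_eq (ha : Φ a = a) : Φ⁻¹ a = a := by
  rw [Equiv.Perm.inv_eq_iff_eq, ha]

theorem hasNorthSouthDynamics_of_affine {k : ℝ} {m : ℂ} (hk0 : 0 < k)
    (hm : m.re = (1 - k) / 2) (hkm : k ≠ 1 ∨ m ≠ 0) (ha : Φ a = a)
    (h : ∀ z, z ≠ a → lineCoord a (Φ z) = k * lineCoord a z + m) : HasNorthSouthDynamics Φ := by
  have ha' : Φ⁻¹ a = a := Circle.perm_inv_apply_eq ha
  have hkC : (k : ℂ) ≠ 0 := by exact_mod_cast hk0.ne'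
  have hinv : ∀ z, z ≠ a → lineCoord a z = k * lineCoord a (Φ⁻¹ z) + m := fun z hz => by
    rw [← h _ (by simpa using iterate_ne_of_fixed ha' hz 1), ← Equiv.Perm.mul_apply,
      mul_inv_cancel, Equiv.Perm.one_apply]
  rcases eq_or_ne k 1 with rfl | hk
  · have hm0 : m ≠ 0 := hkm.resolve_left (not_not.2 rfl)
    refine ⟨a, a, fun z _ _ => tendsto_iterate_of_translation hm0 ha (by simpa using h) z,
      fun z _ _ => tendsto_iterate_of_translation (neg_ne_zero.2 hm0) ha' (fun z hz => ?_) z⟩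
    rw [hinv z hz]
    push_cast
    ring
  have hk1 : (1 : ℂ) - k ≠ 0 := by
    rw [sub_ne_zero]; exact_mod_cast hk.symm
  obtain ⟨u₀, hu₀⟩ : ∃ u₀ : ℂ, u₀ = m / (1 - k) := ⟨_, rfl⟩
  have hmu : m = u₀ * (1 - k) := by rw [hu₀, div_mul_cancel₀ _ hk1]
  have hre : u₀.re = 1 / 2 := by
    have h1 : m.re = u₀.re * (1 - k) := by
      rw [hmu, ← Complex.ofReal_one, ← Complex.ofReal_sub, Complex.re_mul_ofReal]
    have h2 : (1 : ℝ) - k ≠ 0 := sub_ne_zero.2 hk.symm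
    rw [h1] at hm
    field_simp at hm
    linarith
  have hu0 : u₀ ≠ 0 := fun h => by rw [h] at hre; norm_num at hre
  have hnorm : ‖(a : ℂ) - a / u₀‖ = 1 := by
    have h1 : ‖u₀ - 1‖ = ‖u₀‖ := by
      rw [← sq_eq_sq₀ (norm_nonneg _) (norm_nonneg _), ← Complex.normSq_eq_norm_sq,
        ← Complex.normSq_eq_norm_sq, Complex.normSq_apply, Complex.normSq_apply]
      simp only [Complex.sub_re, Complex.sub_im, Complex.one_re, Complex.one_im, hre]
      ring
    have h2 : (a : ℂ) - a / u₀ = a * ((u₀ - 1) / u₀) := by field_simp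
    rw [h2, norm_mul, norm_div, h1, Circle.norm_coe, div_self (norm_ne_zero_iff.2 hu0), one_mul]
  let b : Circle := Circle.ofNormEqOne (a - a / u₀) hnorm
  have hbc : (b : ℂ) = a - a / u₀ := rfl
  have hb : b ≠ a := fun hba => by
    rw [hba, eq_comm, sub_eq_self, div_eq_zero_iff] at hbc
    exact hbc.elim a.coe_ne_zero hu0
  have hbu : lineCoord a b = u₀ := by
    rw [lineCoord, hbc, sub_sub_cancel, div_div_cancel₀ a.coe_ne_zero]
  have h1 : ∀ z, z ≠ a → lineCoord a (Φ z) - lineCoord a b = k * (lineCoord a z - lineCoord a b) :=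
    fun z hz => by rw [h z hz, hbu, hmu]; ring
  have h2 : ∀ z, z ≠ a →
      lineCoord a (Φ⁻¹ z) - lineCoord a b = (k⁻¹ : ℝ) * (lineCoord a z - lineCoord a b) :=
    fun z hz => by
      rw [hinv z hz, hbu, hmu, Complex.ofReal_inv]
      field_simp
      ring
  rcases lt_or_gt_of_ne hk with hlt | hgt
  · exact ⟨b, a, fun z _ hz => tendsto_iterate_of_lt_one hb hk0 hlt ha h1 hz,
      fun z hzb hz => tendsto_iterate_of_one_lt ((one_lt_inv₀ hk0).2 hlt) ha' h2 hz hzb⟩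
  · exact ⟨a, b, fun z hz hzb => tendsto_iterate_of_one_lt hgt ha h1 hz hzb,
      fun z hz _ => tendsto_iterate_of_lt_one hb (inv_pos.2 hk0) (inv_lt_one_of_one_lt₀ hgt) ha'
        h2 hz⟩

theorem mul_mobius_eq_self_iff {α : UnitDisc} {c z : ℂ} (hz : ‖z‖ ≤ 1) :
    c * mobius α z = z ↔ c * (z - α) = z * (1 - conj (α : ℂ) * z) := by
  rw [mobius, ← mul_div_assoc, div_eq_iff (mobius_denom_ne_zero α hz)]

theorem ne_zero_of_mul_mobius_ne_self {α : UnitDisc} {c : Circle}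
    (hfix : ∀ z ∈ Metric.ball (0 : ℂ) 1, c * mobius α z ≠ z) : (α : ℂ) ≠ 0 := fun h =>
  hfix 0 (Metric.mem_ball_self one_pos) (by simp [mobius, h])

theorem exists_mul_mobius_eq_self {α : UnitDisc} {c : Circle}
    (hfix : ∀ z ∈ Metric.ball (0 : ℂ) 1, c * mobius α z ≠ z) :
    ∃ a : Circle, (c : ℂ) * mobius α a = a := by
  have hα := ne_zero_of_mul_mobius_ne_self hfix
  obtain ⟨s, hs⟩ := IsAlgClosed.exists_eq_mul_self
    (discrim (conj (α : ℂ)) ((c : ℂ) - 1) (-(c * α)))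
  obtain ⟨z, hz⟩ := exists_quadratic_eq_zero
    (a := conj (α : ℂ)) (b := (c : ℂ) - 1) (c := -(c * α)) (by simpa using hα) ⟨s, hs⟩
  rcases lt_trichotomy ‖z‖ 1 with hlt | heq | hgt
  · refine absurd ((mul_mobius_eq_self_iff hlt.le).2 ?_) (hfix z (mem_ball_zero_iff.2 hlt))
    linear_combination hz
  · refine ⟨Circle.ofNormEqOne z heq, ?_⟩
    rw [Circle.coe_ofNormEqOne, mul_mobius_eq_self_iff heq.le]
    linear_combination hz
  · have hw : ‖(conj z)⁻¹‖ < 1 := by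
      rw [norm_inv, RCLike.norm_conj]
      exact inv_lt_one_of_one_lt₀ hgt
    refine absurd ((mul_mobius_eq_self_iff hw.le).2 ?_) (hfix _ (mem_ball_zero_iff.2 hw))
    have hz0 : conj z ≠ 0 := by
      rw [← norm_pos_iff, RCLike.norm_conj]
      linarith
    have h1 := congrArg conj hz
    simp only [map_add, map_sub, map_neg, map_mul, conj_conj, map_one, map_zero] at h1
    have hc : (c : ℂ) * conj (c : ℂ) = 1 := by
      rw [mul_conj, Circle.normSq_coe, ofReal_one]
    field_simp
    linear_combination (-(c : ℂ)) * h1 + (conj z - conj (α : ℂ)) * hc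

theorem hasNorthSouthDynamics_mul_mobius {α : UnitDisc} {c : Circle}
    (hfix : ∀ z ∈ Metric.ball (0 : ℂ) 1, c * mobius α z ≠ z) :
    HasNorthSouthDynamics (Equiv.mulLeft c * mobiusCircle α) := by
  have hα := ne_zero_of_mul_mobius_ne_self hfix
  obtain ⟨a, ha⟩ := exists_mul_mobius_eq_self hfix
  have ha' := (mul_mobius_eq_self_iff a.norm_coe.le).1 ha
  have hD : 0 < 1 - normSq α := sub_pos.2 α.normSq_lt_one
  have hDC : ((1 - normSq α : ℝ) : ℂ) = 1 - conj (α : ℂ) * α := by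
    rw [ofReal_sub, ofReal_one, normSq_eq_conj_mul_self]
  have hD0 : (1 : ℂ) - conj (α : ℂ) * α ≠ 0 := by
    rw [← hDC]; exact_mod_cast hD.ne'
  have hden : normSq (1 - conj (α : ℂ) * a) =
      1 - 2 * (conj (α : ℂ) * a).re + normSq α := by
    rw [normSq_sub, normSq_one, normSq_mul, normSq_conj, Circle.normSq_coe, one_mul, conj_re]
    ring
  have hm : ((conj (α : ℂ) * a - (normSq α : ℝ)) / ((1 - normSq α : ℝ) : ℂ)).re =
      ((conj (α : ℂ) * a).re - normSq α) / (1 - normSq α) := by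
    rw [div_ofReal_re, sub_re, ofReal_re]
  refine hasNorthSouthDynamics_of_affine (a := a)
    (k := normSq (1 - conj (α : ℂ) * a) / (1 - normSq α))
    (m := (conj (α : ℂ) * a - (normSq α : ℝ)) / ((1 - normSq α : ℝ) : ℂ))
    (div_pos (normSq_pos.2 (mobius_denom_ne_zero α a.norm_coe.le)) hD) ?_ ?_
    (Circle.ext ha) (fun z hz => ?_)
  · rw [hm, hden]
    field_simp
    ring
  · by_contra! hcon
    obtain ⟨-, hm0⟩ := hcon
    rw [div_eq_zero_iff, or_iff_left (by exact_mod_cast hD.ne'), sub_eq_zero] at hm0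
    have h1 := congrArg normSq hm0
    rw [normSq_mul, normSq_conj, Circle.normSq_coe, mul_one, normSq_ofReal] at h1
    nlinarith [normSq_pos.2 hα]
  · have hza : (a : ℂ) - z ≠ 0 := sub_ne_zero.2 fun h => hz (Circle.ext h.symm)
    have h1 := mobius_denom_ne_zero α z.norm_coe.le
    have haα : (a : ℂ) - α ≠ 0 := fun h => by
      have h2 := α.norm_ne_one
      rw [← sub_eq_zero.1 h] at h2
      exact h2 a.norm_coe
    have h0 := a.coe_ne_zero
    have hk : ((normSq (1 - conj (α : ℂ) * a) : ℝ) : ℂ) =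
        (1 - conj (α : ℂ) * a) * ((a - α) / a) := by
      rw [← mul_conj, map_sub, map_one, map_mul, conj_conj, ← Circle.coe_inv_eq_conj,
        Circle.coe_inv, sub_div, div_self h0]
      rfl
    have hc : (c : ℂ) = a * (1 - conj (α : ℂ) * a) / (a - α) := by
      rw [eq_div_iff haα, ha']
    have h2 : (a : ℂ) - c * mobius α z =
        a * (1 - conj (α : ℂ) * α) * (a - z) / ((a - α) * (1 - conj (α : ℂ) * z)) := by
      rw [mobius, hc, div_mul_div_comm, eq_div_iff (mul_ne_zero haα h1), sub_mul,
        div_mul_cancel₀ _ (mul_ne_zero haα h1)]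
      ring
    have h3 : lineCoord a ((Equiv.mulLeft c * mobiusCircle α) z) =
        (a - α) * (1 - conj (α : ℂ) * z) / ((1 - conj (α : ℂ) * α) * (a - z)) := by
      change (a : ℂ) / (a - c * mobius α z) = _
      rw [h2, div_div_eq_mul_div, mul_assoc (a : ℂ) (1 - conj (α : ℂ) * α),
        mul_div_mul_left _ _ h0]
    rw [h3, ofReal_div, hk, hDC, lineCoord, normSq_eq_conj_mul_self,
      div_eq_iff (mul_ne_zero hD0 hza)]
    obtain ⟨D, hD⟩ : ∃ D : ℂ, 1 - conj (α : ℂ) * α = D := ⟨_, rfl⟩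
    have hD' : conj (α : ℂ) * α = 1 - D := by rw [← hD, sub_sub_cancel]
    rw [hD] at hD0 ⊢
    rw [hD']
    field_simp
    linear_combination (-((a : ℂ) - z)) * hD'

end Dynamics

/-! ### Chaos of composition operators induced by disk automorphisms -/

section Main

open Complex

theorem inv_mulLeft_circle (c : Circle) : (Equiv.mulLeft c)⁻¹ = Equiv.mulLeft c⁻¹ :=
  Equiv.ext fun _ => rfl

theorem lipschitzWith_conj_mulLeft_pow (B : Equiv.Perm Circle) {K L : ℝ≥0} (hK : LipschitzWith K B)
    (hL : LipschitzWith L ⇑B⁻¹) (c : Circle) (n : ℕ) :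
    LipschitzWith (L * K) ⇑((B⁻¹ * Equiv.mulLeft c * B) ^ n) := by
  have h1 : (B⁻¹ * Equiv.mulLeft c * B) ^ n = B⁻¹ * Equiv.mulLeft c ^ n * B := by
    simpa using conj_pow (a := B⁻¹) (b := Equiv.mulLeft c) (i := n)
  have h2 := (isometry_mulLeft_circle c).lipschitz.iterate n
  rw [one_pow, Equiv.Perm.iterate_eq_pow] at h2
  have h3 := (hL.comp h2).comp hK
  rw [mul_one] at h3
  rw [h1]
  exact h3

variable (p : ℝ≥0∞) [Fact (1 ≤ p)] (hp : p ≠ ∞) {ψ : Circle → Circle}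

theorem not_chaotic_of_conj_mulLeft (h : IsInducingMap circleMeasure ψ) (α : UnitDisc) (c : Circle)
    (hψ : ψ = ((mobiusCircle α)⁻¹ * Equiv.mulLeft c * mobiusCircle α : Equiv.Perm Circle)) :
    ¬ LiYorkeChaotic (compositionOperator p hp h) ∧
      ¬ TopologicallyTransitive (compositionOperator p hp h) := by
  subst hψ
  obtain ⟨K, hK⟩ := exists_lipschitzWith_mobiusCircle α
  obtain ⟨L, hL⟩ := exists_lipschitzWith_mobiusCircle (-α)
  rw [← mobiusCircle_inv] at hL
  have h1 := lipschitzWith_conj_mulLeft_pow _ hK hL c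
  have h2 := lipschitzWith_conj_mulLeft_pow _ hK hL c⁻¹
  have hinv : (mobiusCircle α)⁻¹ * Equiv.mulLeft c⁻¹ * mobiusCircle α =
      ((mobiusCircle α)⁻¹ * Equiv.mulLeft c * mobiusCircle α)⁻¹ := by
    rw [mul_inv_rev, mul_inv_rev, inv_inv, inv_mulLeft_circle, mul_assoc]
  rw [hinv] at h2
  have h' := isInducingMap_of_lipschitzWith (by simpa only [pow_one] using h2 1)
    (by simpa only [pow_one, inv_inv] using h1 1)
  exact ⟨not_liYorkeChaotic_of_norm_le
      (norm_le_norm_compositionOperator_pow_of_lipschitzWith p hp h1 h h'),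
    not_topologicallyTransitive_of_norm_le
      (norm_compositionOperator_pow_le_of_lipschitzWith p hp h2 h)⟩

theorem chaotic_of_hasNorthSouthDynamics {Φ : Equiv.Perm Circle} (hΦ : HasNorthSouthDynamics Φ)
    (h : IsInducingMap circleMeasure ψ) (h' : IsInducingMap circleMeasure ⇑Φ⁻¹) (hψ : ψ = Φ) :
    DenselyDistributionallyChaotic (compositionOperator p hp h) ∧
      TopologicallyMixing (compositionOperator p hp h) := by
  subst hψ
  obtain ⟨a, b, ha, hb⟩ := hΦ
  have hne : ∀ᵐ z ∂circleMeasure, z ≠ a ∧ z ≠ b := by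
    filter_upwards [(Set.to_countable ({a, b} : Set Circle)).ae_notMem circleMeasure] with z hz
    simpa [not_or] using hz
  have ha' := hne.mono fun z hz => ha z hz.1 hz.2
  have hb' := hne.mono fun z hz => hb z hz.1 hz.2
  have hdT := dense_tendsto_compositionOperator_pow_zero p hp h ha'
  have hdS := dense_tendsto_compositionOperator_pow_zero p hp h' hb'
  have : Fact (p ≠ ∞) := ⟨hp⟩
  obtain ⟨x, hx⟩ := exists_isDistributionallyIrregular hdT one_half_pos fun η hη =>
    exists_norm_lt_and_eventually_le_norm_compositionOperator_pow p hp h ha' hη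
  refine ⟨hx.denselyDistributionallyChaotic hdT, topologicallyMixing_of_dense
    (compositionOperator_mul_eq_one p hp h h' fun z => ?_) hdT hdS⟩
  rw [← Equiv.Perm.mul_apply, inv_mul_cancel, Equiv.Perm.one_apply]

theorem isInducingMap_conj_mobiusCircle (α β : UnitDisc) (c : Circle) :
    IsInducingMap circleMeasure
      ((mobiusCircle β)⁻¹ * Equiv.mulLeft c * mobiusCircle α : Equiv.Perm Circle) := by
  have hlip : ∀ (α β : UnitDisc) (c : Circle), ∃ K,
      LipschitzWith K ((mobiusCircle β)⁻¹ * Equiv.mulLeft c * mobiusCircle α : Equiv.Perm Circle) :=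
    fun α β c => by
      obtain ⟨K, hK⟩ := exists_lipschitzWith_mobiusCircle α
      obtain ⟨L, hL⟩ := exists_lipschitzWith_mobiusCircle (-β)
      exact ⟨_, (hL.comp (isometry_mulLeft_circle c).lipschitz).comp hK⟩
  obtain ⟨K, hK⟩ := hlip α β c
  obtain ⟨L, hL⟩ := hlip β α c⁻¹
  refine isInducingMap_of_lipschitzWith hK (L := L) ?_
  convert hL using 2
  rw [mul_inv_rev, mul_inv_rev, inv_inv, inv_mulLeft_circle, mul_assoc]

end Main

theorem mainTheorem1 (p : ℝ≥0∞) [Fact (1 ≤ p)] (hp : p ≠ ∞) (φ : ℂ → ℂ)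
    (hφ : IsDiskAutomorphism φ) :
    (∀ ζ : Circle, HasBoundaryValue φ ζ (boundaryMap φ ζ)) ∧
    ∃ h : IsInducingMap circleMeasure (boundaryMap φ),
      List.TFAE [
        LiYorkeChaotic (compositionOperator p hp h),
        DistributionallyChaotic (compositionOperator p hp h),
        DenselyDistributionallyChaotic (compositionOperator p hp h),
        TopologicallyTransitive (compositionOperator p hp h),
        TopologicallyMixing (compositionOperator p hp h),
        ¬ ∃ z ∈ Metric.ball (0 : ℂ) 1, φ z = z] := by
  obtain ⟨α, hα⟩ : ∃ α : Complex.UnitDisc, φ α = 0 := by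
    obtain ⟨-, -, g, -, hg, -, hφg⟩ := hφ
    have h0 : (0 : ℂ) ∈ Metric.ball (0 : ℂ) 1 := Metric.mem_ball_self one_pos
    exact ⟨Complex.UnitDisc.mk (g 0) (mem_ball_zero_iff.1 (hg h0)), hφg h0⟩
  obtain ⟨c, hc⟩ := hφ.exists_eq_mobius (w₀ := 0) hα
  have hb := boundaryMap_eq_of_eqOn_mobius hc
  have hind : IsInducingMap circleMeasure (boundaryMap φ) :=
    hb ▸ isInducingMap_conj_mobiusCircle α 0 c
  refine ⟨fun ζ => hb ▸ hasBoundaryValue_of_eqOn_mobius hc ζ, hind, ?_⟩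
  have helliptic : (∃ z ∈ Metric.ball (0 : ℂ) 1, φ z = z) →
      ¬ LiYorkeChaotic (compositionOperator p hp hind) ∧
        ¬ TopologicallyTransitive (compositionOperator p hp hind) := by
    rintro ⟨z, hz, hφz⟩
    obtain ⟨d, hd⟩ := hφ.exists_eq_mobius (z₀ := .mk z (mem_ball_zero_iff.1 hz))
      (w₀ := .mk z (mem_ball_zero_iff.1 hz)) (by simpa using hφz)
    exact not_chaotic_of_conj_mulLeft p hp hind _ d (boundaryMap_eq_of_eqOn_mobius hd)
  have hchaotic : (¬ ∃ z ∈ Metric.ball (0 : ℂ) 1, φ z = z) →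
      DenselyDistributionallyChaotic (compositionOperator p hp hind) ∧
        TopologicallyMixing (compositionOperator p hp hind) := by
    intro hfix
    have hone : (mobiusCircle 0)⁻¹ = 1 := by
      rw [inv_eq_one]
      exact Equiv.ext fun z => Circle.ext (by rw [coe_mobiusCircle, mobius_zero_left]; rfl)
    rw [hone, one_mul] at hb
    have hns : HasNorthSouthDynamics (Equiv.mulLeft c * mobiusCircle α) :=
      hasNorthSouthDynamics_mul_mobius fun z hz h => hfix ⟨z, hz, by
        rw [hc z hz, neg_zero, mobius_zero_left, h]⟩
    have hinv : (mobiusCircle α)⁻¹ * Equiv.mulLeft c⁻¹ * mobiusCircle 0 =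
        (Equiv.mulLeft c * mobiusCircle α)⁻¹ := by
      rw [inv_eq_one.1 hone, mul_one, mul_inv_rev, inv_mulLeft_circle]
    exact chaotic_of_hasNorthSouthDynamics p hp hns hind
      (hinv ▸ isInducingMap_conj_mobiusCircle 0 α c⁻¹) hb
  tfae_have 3 → 2 := DenselyDistributionallyChaotic.distributionallyChaotic
  tfae_have 2 → 1 := DistributionallyChaotic.liYorkeChaotic
  tfae_have 1 → 6 := fun h hfix => (helliptic hfix).1 h
  tfae_have 6 → 3 := fun h => (hchaotic h).1
  tfae_have 5 → 4 := TopologicallyMixing.topologicallyTransitive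
  tfae_have 4 → 6 := fun h hfix => (helliptic hfix).2 h
  tfae_have 6 → 5 := fun h => (hchaotic h).2
  tfae_finish
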